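/- Let $a<b$, $T>0$, $\delta>0$, $\nu>0$ and an integer $k\ge 0$ be fixed. Let $\gamma:\mathbb R\to[0,\infty)$ be even, with $\gamma\in L^1_{\rm loc}(\mathbb R)$ and $0<\int_{-\delta}^{\delta}s^2\gamma(s)\,ds<\infty$. Let $(u,q)$ be a solution, $(b-a)$-periodic in $x$, of the nonlocal wave equation $$u_{tt}(x,t)-2\int_0^\delta s^2\gamma(s)\,\tfrac1s\big(q(x,t;s)-q(x-s,t;s)\big)\,ds=0,\qquad q(x,t;s)=\tfrac1s\big(u(x+s,t)-u(x,t)\big),\quad 0<s\le\delta,$$ for $(x,t)\in(a,b)\times(0,T)$ (the second relation for all $x\in\mathbb R$, $t\in[0,T]$), smooth in the sense that $u,u_t,u_{tt}$ exist and are continuous on $\mathbb R\times[0,T]$ and $u(\cdot,t),u_t(\cdot,t)\in C^{k+1}(\mathbb R)$ for every $t\in[0,T]$. Let $A$ be such that for all $t\in[0,T]$ and $s\in(0,\delta]$ $$|u(\cdot,t)|_{H^{k+1}(a,b)}\le A,\qquad |u_t(\cdot,t)|_{H^{k+1}(a,b)}\le A,\qquad |q(\cdot,t;s)|_{H^{k+1}(a,b)}\le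 A,$$ where $|f|_{H^{m}(a,b)}=\|f^{(m)}\|_{L^2(a,b)}$. Let $a=x_{1/2}<x_{3/2}<\dots<x_{N+1/2}=b$ be a partition into cells $I_j=(x_{j-1/2},x_{j+1/2})$ of lengths $h_j$, put $h=\max_j h_j$, and assume $\nu h\le\min_j h_j$. Let $V_h^k$ be the space of functions that are polynomials of degree at most $k$ on each $I_j$, extended $(b-a)$-periodically to $\mathbb R$, and let $P_h$ denote the $L^2$-projection onto $V_h^k$. Let $(u_h,q_h)$ be the semi-discrete discontinuous Galerkin solution: $u_h(\cdot,t),q_h(\cdot,t;s)\in V_h^k$ for $t\in[0,T]$ and $s\in(0,\delta]$, $u_h$ is twice continuously differentiable in $t\in[0,T]$, and for all $t\in[0,T]$, all $j$ and all $v,w\in V_h^k$ $$\int_{I_j}(u_h)_{tt}\,v\,dx-2\int_0^\delta s^2\gamma(s)\int_{I_j}\tfrac1s\big(q_h(x,t;s)-q_h(x-s,t;s)\big)v(x)\,dx\,ds=0,$$ $$\int_{I_j}q_h(x,t;s)\,w(x)\,dx-\int_{I_j}\tfrac1s\big(u_h(x+s,t)-u_h(x,t)\big)w(x)\,dx=0\qquad(0<s\le\delta),$$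 with initial data $u_h(\cdot,0)=P_hu(\cdot,0)$ and $(u_h)_t(\cdot,0)=P_hu_t(\cdot,0)$. Then the error $e_u=u_h-u$ satisfies $$\|e_u(\cdot,t)\|_{L^2(a,b)}^2\le C\,h^{2k+2}\qquad\text{for all }t\in[0,T],$$ with a constant $C>0$ that depends only on $\gamma$, $\delta$, $A$, $k$, $T$, $a$, $b$ and $\nu$; in particular $C$ is independent of the partition and of $h$. -/

import Mathlib

open MeasureTheory Set

namespace NonlocalWave

noncomputable section

/-- The time derivative, on the closed interval `[0, T]`, of a function `u t x` of time and space
(one-sided at the two endpoints). -/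
def timeDeriv (T : ℝ) (u : ℝ → ℝ → ℝ) (t x : ℝ) : ℝ :=
  derivWithin (fun r => u r x) (Icc 0 T) t

/-- The Sobolev seminorm `|f|_{H^m(a,b)} = ‖f^{(m)}‖_{L²(a,b)}` of a function of class `C^m`. -/
def sobolevSeminorm (a b : ℝ) (m : ℕ) (f : ℝ → ℝ) : ℝ :=
  Real.sqrt (∫ x in a..b, (iteratedDeriv m f x) ^ 2)

/-- A nonnegative radial kernel `γ(x, y) = γ(x - y)` with
`0 < C_δ = ∫_{-δ}^{δ} s² γ(s) ds < ∞`. -/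
structure IsKernel (δ : ℝ) (γ : ℝ → ℝ) : Prop where
  nonneg : ∀ s, 0 ≤ γ s
  even : ∀ s, γ (-s) = γ s
  integrable : IntervalIntegrable (fun s => s ^ 2 * γ s) volume (-δ) δ
  pos : 0 < ∫ s in (-δ)..δ, s ^ 2 * γ s

/-- `(u, q)`, written `u t x` and `q t s x`, is a smooth `(b - a)`-periodic solution on `[0, T]` of
the nonlocal wave equation in first order form
`u_tt = 2 ∫_0^δ s² γ(s) (1/s) (q(x,t;s) - q(x-s,t;s)) ds`,
`q(x,t;s) = (1/s) (u(x+s,t) - u(x,t))`,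
where `u` and `u_t` are of class `C^{k+1}` in space and `u`, `u_t`, `u_tt` are jointly continuous. -/
structure IsSmoothSolution (a b T δ : ℝ) (γ : ℝ → ℝ) (k : ℕ)
    (u : ℝ → ℝ → ℝ) (q : ℝ → ℝ → ℝ → ℝ) : Prop where
  periodic : ∀ t ∈ Icc 0 T, Function.Periodic (u t) (b - a)
  contDiff_time : ∀ x, ContDiffOn ℝ 2 (fun t => u t x) (Icc 0 T)
  continuous_u : ContinuousOn (fun p : ℝ × ℝ => u p.1 p.2) (Icc 0 T ×ˢ univ)
  continuous_ut : ContinuousOn (fun p : ℝ × ℝ => timeDeriv T u p.1 p.2) (Icc 0 T ×ˢ univ)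
  continuous_utt :
    ContinuousOn (fun p : ℝ × ℝ => timeDeriv T (timeDeriv T u) p.1 p.2) (Icc 0 T ×ˢ univ)
  contDiff_u : ∀ t ∈ Icc 0 T, ContDiff ℝ ((k + 1 : ℕ) : WithTop ℕ∞) (u t)
  contDiff_ut : ∀ t ∈ Icc 0 T, ContDiff ℝ ((k + 1 : ℕ) : WithTop ℕ∞) (timeDeriv T u t)
  wave_eq : ∀ t ∈ Ioo 0 T, ∀ x ∈ Ioo a b,
    timeDeriv T (timeDeriv T u) t x
      - 2 * ∫ s in (0 : ℝ)..δ, s ^ 2 * γ s * ((1 / s) * (q t s x - q t s (x - s))) = 0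
  grad_eq : ∀ t ∈ Icc 0 T, ∀ s ∈ Ioc 0 δ, ∀ x,
    q t s x - (1 / s) * (u t (x + s) - u t x) = 0

/-- A partition `a = node 0 < node 1 < ⋯ < node N = b` of the interval `(a, b)`. -/
structure Mesh (a b : ℝ) where
  N : ℕ
  node : Fin (N + 1) → ℝ
  strictMono : StrictMono node
  node_zero : node 0 = a
  node_last : node (Fin.last N) = b

namespace Mesh

variable {a b : ℝ}

/-- The left endpoint of the cell `I_j`. -/
def left (M : Mesh a b) (j : Fin M.N) : ℝ := M.node j.castSucc

/-- The right endpoint of the cell `I_j`. -/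
def right (M : Mesh a b) (j : Fin M.N) : ℝ := M.node j.succ

/-- The length `h_j` of the cell `I_j`. -/
def cellLength (M : Mesh a b) (j : Fin M.N) : ℝ := M.right j - M.left j

/-- The mesh size `h = max_j h_j`. -/
def size (M : Mesh a b) : ℝ := ⨆ j, M.cellLength j

/-- Regularity of the partition: `ν max_j h_j ≤ min_j h_j`. -/
def IsRegular (M : Mesh a b) (ν : ℝ) : Prop := ∀ j, ν * M.size ≤ M.cellLength j

/-- The space `V_h^k` of functions that are polynomials of degree at most `k` on each open cell,
extended `(b - a)`-periodically to the line (the values at the nodes are immaterial). -/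
def dgSpace (M : Mesh a b) (k : ℕ) : Submodule ℝ (ℝ → ℝ) where
  carrier := {v | Function.Periodic v (b - a) ∧ ∀ j : Fin M.N, ∃ p : Polynomial ℝ,
    p.natDegree ≤ k ∧ ∀ x ∈ Ioo (M.left j) (M.right j), v x = p.eval x}
  zero_mem' := ⟨fun _ => rfl, fun _ => ⟨0, by simp, by simp⟩⟩
  add_mem' := by
    rintro v w ⟨hv, hv'⟩ ⟨hw, hw'⟩
    refine ⟨hv.add hw, fun j => ?_⟩
    obtain ⟨p, hp, hp'⟩ := hv' j
    obtain ⟨r, hr, hr'⟩ := hw' j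
    refine ⟨p + r, Polynomial.natDegree_add_le_of_degree_le hp hr, fun x hx => ?_⟩
    simp [hp' x hx, hr' x hx]
  smul_mem' := by
    rintro c v ⟨hv, hv'⟩
    refine ⟨hv.smul c, fun j => ?_⟩
    obtain ⟨p, hp, hp'⟩ := hv' j
    refine ⟨c • p, (Polynomial.natDegree_smul_le c p).trans hp, fun x hx => ?_⟩
    simp [hp' x hx]

/-- `H_j(v, w; s) = ∫_{I_j} (1/s) (v(x+s) - v(x)) w(x) dx`. -/
def opH (M : Mesh a b) (j : Fin M.N) (v w : ℝ → ℝ) (s : ℝ) : ℝ :=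
  ∫ x in (M.left j)..(M.right j), (1 / s) * (v (x + s) - v x) * w x

/-- `K_j(v, w; s) = ∫_{I_j} (1/s) (v(x) - v(x-s)) w(x) dx`. -/
def opK (M : Mesh a b) (j : Fin M.N) (v w : ℝ → ℝ) (s : ℝ) : ℝ :=
  ∫ x in (M.left j)..(M.right j), (1 / s) * (v x - v (x - s)) * w x

/-- `g = P_h f` is the `L²`-projection of `f` onto `V_h^k`. -/
def IsL2Projection (M : Mesh a b) (k : ℕ) (f g : ℝ → ℝ) : Prop :=
  g ∈ M.dgSpace k ∧ ∀ j : Fin M.N, ∀ p : Polynomial ℝ, p.natDegree ≤ k →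
    ∫ x in (M.left j)..(M.right j), (f x - g x) * p.eval x = 0

/-- `(u_h, q_h)`, written `uh t x` and `qh t s x`, solves the semi-discrete discontinuous Galerkin
scheme on `[0, T]`: it takes values in `V_h^k`, `u_h` is twice continuously differentiable in time,
and on every cell and for all test functions in `V_h^k`
`∫_{I_j} (u_h)_tt v dx - 2 ∫_0^δ s² γ(s) K_j(q_h, v; s) ds = 0`,
`∫_{I_j} q_h w dx - H_j(u_h, w; s) = 0` for `0 < s ≤ δ`. -/
structure IsDGSolution (M : Mesh a b) (k : ℕ) (T δ : ℝ) (γ : ℝ → ℝ)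
    (uh : ℝ → ℝ → ℝ) (qh : ℝ → ℝ → ℝ → ℝ) : Prop where
  mem_uh : ∀ t ∈ Icc 0 T, uh t ∈ M.dgSpace k
  mem_qh : ∀ t ∈ Icc 0 T, ∀ s ∈ Ioc 0 δ, qh t s ∈ M.dgSpace k
  contDiff_time : ∀ j : Fin M.N, ∀ x ∈ Ioo (M.left j) (M.right j),
    ContDiffOn ℝ 2 (fun t => uh t x) (Icc 0 T)
  wave_eq : ∀ t ∈ Icc 0 T, ∀ v ∈ M.dgSpace k, ∀ j : Fin M.N,
    (∫ x in (M.left j)..(M.right j), timeDeriv T (timeDeriv T uh) t x * v x)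
      - 2 * ∫ s in (0 : ℝ)..δ, s ^ 2 * γ s * M.opK j (qh t s) v s = 0
  grad_eq : ∀ t ∈ Icc 0 T, ∀ s ∈ Ioc 0 δ, ∀ w ∈ M.dgSpace k, ∀ j : Fin M.N,
    (∫ x in (M.left j)..(M.right j), qh t s x * w x) - M.opH j (uh t) w s = 0

end Mesh

end

end NonlocalWave

/-!
Write `D_s` for the difference quotient with step `s`, so that `q(·,t;s) = D_s u(·,t)` and the two
equations involve `D_{-s} q` and `D_{-s} q_h`. Testing with a fixed `φ ∈ V_h^k` gives
`∫ (u_h - u)_tt φ = 2 ∫_0^δ s² γ(s) ∫ D_{-s} (q_h - q) φ dx ds`. Since `D_s` commutes with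
derivatives and has norm at most `2 / s` on `L²`, and `q_h(·,t;s)` is the projection of `D_s u_h`,
the difference `q_h - q` is at most `2 / s` times `‖u_h - u‖ + O(h^{k+1})`; the weight `s²` absorbs
the two factors `1 / s`. Integrating twice in time, with vanishing initial moments because the
initial data are projections, and comparing with the best approximation of `u` in `V_h^k` bounds
`‖u_h - u‖` at time `t` by a double time integral of itself plus `O(h^{k+1})`. In the supremum of
`exp (-λ t) ‖(u_h - u)(t)‖` the double integral gains a factor `λ⁻²`, hence is absorbed for large
`λ`.
-/

namespace NonlocalWave

noncomputable section

variable {a b : ℝ}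

/-! ### The norm of `L²` -/

section Norm

variable {α : Type*} [MeasurableSpace α] {μ : Measure α} {f g : α → ℝ}

theorem sq_lpNorm_two (hf : AEStronglyMeasurable f μ) : lpNorm f 2 μ ^ 2 = ∫ x, f x ^ 2 ∂μ := by
  rw [lpNorm_eq_integral_norm_rpow_toReal two_ne_zero ENNReal.ofNat_ne_top hf,
    ENNReal.toReal_ofNat, ← Real.rpow_mul_natCast (by positivity)]
  simp

theorem abs_integral_mul_le_lpNorm_mul_lpNorm (hf : MemLp f 2 μ) (hg : MemLp g 2 μ) :
    |∫ x, f x * g x ∂μ| ≤ lpNorm f 2 μ * lpNorm g 2 μ := by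
  have holder := integral_mul_norm_le_Lp_mul_Lq (μ := μ) (f := f) (g := g)
    Real.HolderConjugate.two_two (by simpa using hf) (by simpa using hg)
  rw [lpNorm_eq_integral_norm_rpow_toReal two_ne_zero ENNReal.ofNat_ne_top hf.1,
    lpNorm_eq_integral_norm_rpow_toReal two_ne_zero ENNReal.ofNat_ne_top hg.1]
  calc |∫ x, f x * g x ∂μ| ≤ ∫ x, ‖f x‖ * ‖g x‖ ∂μ := by
        simpa only [norm_mul, Real.norm_eq_abs] using
          norm_integral_le_integral_norm (fun x => f x * g x)
    _ ≤ _ := by simpa using holder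

theorem lpNorm_le_of_integral_sub_mul_self_eq_zero (hf : MemLp f 2 μ) (hg : MemLp g 2 μ)
    (horth : ∫ x, (f x - g x) * g x ∂μ = 0) : lpNorm g 2 μ ≤ lpNorm f 2 μ := by
  have hsq : lpNorm g 2 μ ^ 2 = ∫ x, f x * g x ∂μ := by
    have hsub := integral_sub (hf.integrable_mul hg) (hg.integrable_mul hg)
    simp only [Pi.mul_apply, ← sub_mul, horth] at hsub
    simpa only [sq_lpNorm_two hg.1, pow_two] using (sub_eq_zero.1 hsub.symm).symm
  rcases (lpNorm_nonneg (f := g) (p := 2) (μ := μ)).eq_or_lt with h0 | hpos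
  · exact h0 ▸ lpNorm_nonneg
  · refine le_of_mul_le_mul_right ?_ hpos
    rw [← pow_two, hsq]
    exact (le_abs_self _).trans (abs_integral_mul_le_lpNorm_mul_lpNorm hf hg)

end Norm

/-- The norm of `L²(a, b)`. -/
abbrev l2norm (a b : ℝ) (f : ℝ → ℝ) : ℝ := lpNorm f 2 (volume.restrict (Ioc a b))

theorem sq_l2norm (hab : a ≤ b) {f : ℝ → ℝ}
    (hf : AEStronglyMeasurable f (volume.restrict (Ioc a b))) :
    l2norm a b f ^ 2 = ∫ x in a..b, f x ^ 2 := by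
  rw [sq_lpNorm_two hf, intervalIntegral.integral_of_le hab]

theorem sobolevSeminorm_eq_l2norm (hab : a ≤ b) {m : ℕ} {f : ℝ → ℝ} (hf : ContDiff ℝ m f) :
    sobolevSeminorm a b m f = l2norm a b (iteratedDeriv m f) := by
  rw [sobolevSeminorm, ← sq_l2norm hab (hf.continuous_iteratedDeriv' m).aestronglyMeasurable,
    Real.sqrt_sq lpNorm_nonneg]

/-- The essentially bounded functions of period `L`: a class that contains both the exact and the
discrete solutions and is stable under difference quotients. -/
def boundedPeriodic (L : ℝ) : Submodule ℝ (ℝ → ℝ) where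
  carrier := {v | Function.Periodic v L ∧ MemLp v ⊤ volume}
  zero_mem' := ⟨fun _ => rfl, MemLp.zero⟩
  add_mem' hv hw := ⟨hv.1.add hw.1, hv.2.add hw.2⟩
  smul_mem' c _ hv := ⟨hv.1.smul c, hv.2.const_smul c⟩

theorem memLp_two_of_mem_boundedPeriodic {L : ℝ} {v : ℝ → ℝ} (hv : v ∈ boundedPeriodic L)
    (l r : ℝ) : MemLp v 2 (volume.restrict (Ioc l r)) :=
  (hv.2.restrict _).mono_exponent le_top

theorem intervalIntegrable_mul_of_mem_boundedPeriodic {L : ℝ} {v w : ℝ → ℝ}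
    (hv : v ∈ boundedPeriodic L) (hw : w ∈ boundedPeriodic L) (l r : ℝ) :
    IntervalIntegrable (fun x => v x * w x) volume l r :=
  ⟨(memLp_two_of_mem_boundedPeriodic hv l r).integrable_mul
      (memLp_two_of_mem_boundedPeriodic hw l r),
    (memLp_two_of_mem_boundedPeriodic hv r l).integrable_mul
      (memLp_two_of_mem_boundedPeriodic hw r l)⟩

theorem integral_sub_mul_of_mem_boundedPeriodic {L : ℝ} {v w φ : ℝ → ℝ}
    (hv : v ∈ boundedPeriodic L) (hw : w ∈ boundedPeriodic L) (hφ : φ ∈ boundedPeriodic L)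
    (l r : ℝ) :
    ∫ x in l..r, (v - w) x * φ x = (∫ x in l..r, v x * φ x) - ∫ x in l..r, w x * φ x := by
  simp only [Pi.sub_apply, sub_mul]
  exact intervalIntegral.integral_sub (intervalIntegrable_mul_of_mem_boundedPeriodic hv hφ l r)
    (intervalIntegrable_mul_of_mem_boundedPeriodic hw hφ l r)

theorem intervalIntegrable_of_mem_boundedPeriodic {L : ℝ} {v : ℝ → ℝ}
    (hv : v ∈ boundedPeriodic L) (l r : ℝ) : IntervalIntegrable v volume l r :=
  ⟨(memLp_two_of_mem_boundedPeriodic hv l r).integrable one_le_two,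
    (memLp_two_of_mem_boundedPeriodic hv r l).integrable one_le_two⟩

theorem mem_boundedPeriodic_of_continuous {L : ℝ} (hL : L ≠ 0) {v : ℝ → ℝ} (hv : Continuous v)
    (hper : Function.Periodic v L) : v ∈ boundedPeriodic L := by
  obtain ⟨C, hC⟩ := (hper.isBounded_of_continuous hL hv).exists_norm_le
  exact ⟨hper, memLp_top_of_bound hv.aestronglyMeasurable C
    (Filter.Eventually.of_forall fun x => hC _ (mem_range_self x))⟩

theorem comp_add_mem_boundedPeriodic {L : ℝ} {v : ℝ → ℝ} (hv : v ∈ boundedPeriodic L) (s : ℝ) :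
    (fun x => v (x + s)) ∈ boundedPeriodic L :=
  ⟨fun x => by simp only [add_right_comm x L s, hv.1 (x + s)],
    hv.2.comp_measurePreserving (measurePreserving_add_right volume s)⟩

theorem l2norm_comp_add (hab : a ≤ b) {v : ℝ → ℝ} (hv : v ∈ boundedPeriodic (b - a)) (s : ℝ) :
    l2norm a b (fun x => v (x + s)) = l2norm a b v := by
  rw [← pow_left_inj₀ lpNorm_nonneg lpNorm_nonneg two_ne_zero, sq_l2norm hab
    (memLp_two_of_mem_boundedPeriodic (comp_add_mem_boundedPeriodic hv s) a b).1,
    sq_l2norm hab (memLp_two_of_mem_boundedPeriodic hv a b).1,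
    intervalIntegral.integral_comp_add_right (fun x => v x ^ 2)]
  have hper : Function.Periodic (fun x => v x ^ 2) (b - a) := fun x => by simp only [hv.1 x]
  have := hper.intervalIntegral_add_eq (a + s) a
  rwa [add_right_comm, add_sub_cancel] at this

theorem abs_integral_mul_le_l2norm_mul {l r : ℝ} (hal : a ≤ l) (hlr : l ≤ r) (hrb : r ≤ b)
    {v w : ℝ → ℝ} (hv : v ∈ boundedPeriodic (b - a)) (hw : w ∈ boundedPeriodic (b - a)) :
    |∫ x in l..r, v x * w x| ≤ l2norm a b v * l2norm a b w := by
  have mono : ∀ f ∈ boundedPeriodic (b - a), l2norm l r f ≤ l2norm a b f := fun f hf => by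
    have hm := memLp_two_of_mem_boundedPeriodic hf
    rw [l2norm, l2norm, ← toReal_eLpNorm (hm l r).1, ← toReal_eLpNorm (hm a b).1]
    exact ENNReal.toReal_mono (hm a b).eLpNorm_ne_top
      (eLpNorm_mono_measure f (Measure.restrict_mono (Ioc_subset_Ioc hal hrb) le_rfl))
  rw [intervalIntegral.integral_of_le hlr]
  exact (abs_integral_mul_le_lpNorm_mul_lpNorm (memLp_two_of_mem_boundedPeriodic hv l r)
    (memLp_two_of_mem_boundedPeriodic hw l r)).trans
      (mul_le_mul (mono v hv) (mono w hw) lpNorm_nonneg lpNorm_nonneg)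

/-! ### Difference quotients -/

/-- The difference quotient `x ↦ (v (x + s) - v x) / s`. A negative step gives the backward
difference quotient of the scheme, and `s = 0` the zero map. -/
def diffQuot (s : ℝ) : (ℝ → ℝ) →ₗ[ℝ] (ℝ → ℝ) :=
  s⁻¹ • (LinearMap.funLeft ℝ ℝ (· + s) - LinearMap.id)

theorem diffQuot_apply (s : ℝ) (v : ℝ → ℝ) (x : ℝ) :
    diffQuot s v x = 1 / s * (v (x + s) - v x) := by
  simp [diffQuot, LinearMap.funLeft_apply]

theorem diffQuot_neg_apply (s : ℝ) (v : ℝ → ℝ) (x : ℝ) :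
    diffQuot (-s) v x = 1 / s * (v x - v (x - s)) := by
  rw [diffQuot_apply, ← sub_eq_add_neg]
  ring

theorem diffQuot_mem_boundedPeriodic {L : ℝ} {v : ℝ → ℝ} (hv : v ∈ boundedPeriodic L) (s : ℝ) :
    diffQuot s v ∈ boundedPeriodic L :=
  Submodule.smul_mem _ _ (Submodule.sub_mem _ (comp_add_mem_boundedPeriodic hv s) hv)

theorem l2norm_diffQuot_le (hab : a ≤ b) {v : ℝ → ℝ} (hv : v ∈ boundedPeriodic (b - a)) (s : ℝ) :
    l2norm a b (diffQuot s v) ≤ 2 / |s| * l2norm a b v := by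
  have htri : l2norm a b ((fun x => v (x + s)) - v) ≤ l2norm a b v + l2norm a b v := by
    conv_rhs => enter [1]; rw [← l2norm_comp_add hab hv s]
    exact lpNorm_sub_le (memLp_two_of_mem_boundedPeriodic (comp_add_mem_boundedPeriodic hv s) a b)
      one_le_two
  calc l2norm a b (diffQuot s v) = |s|⁻¹ * l2norm a b ((fun x => v (x + s)) - v) := by
        rw [show diffQuot s v = s⁻¹ • ((fun x => v (x + s)) - v) from rfl, l2norm,
          lpNorm_const_smul, coe_nnnorm, norm_inv, Real.norm_eq_abs]
    _ ≤ |s|⁻¹ * (l2norm a b v + l2norm a b v) := by gcongr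
    _ = 2 / |s| * l2norm a b v := by ring

theorem contDiff_diffQuot {n : WithTop ℕ∞} {f : ℝ → ℝ} (hf : ContDiff ℝ n f) (s : ℝ) :
    ContDiff ℝ n (diffQuot s f) := by
  rw [show diffQuot s f = fun x => 1 / s * (f (x + s) - f x) from funext (diffQuot_apply s f)]
  fun_prop

theorem iteratedDeriv_diffQuot {m : ℕ} {f : ℝ → ℝ} (hf : ContDiff ℝ m f) (s : ℝ) :
    iteratedDeriv m (diffQuot s f) = diffQuot s (iteratedDeriv m f) := by
  rw [show diffQuot s f = fun x => 1 / s * (f (x + s) - f x) from funext (diffQuot_apply s f)]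
  have hshift : ContDiff ℝ m fun x => f (x + s) := by fun_prop
  ext x
  rw [iteratedDeriv_const_mul_field, iteratedDeriv_fun_sub hshift.contDiffAt hf.contDiffAt,
    iteratedDeriv_comp_add_const, diffQuot_apply]

theorem periodic_iteratedDeriv {L : ℝ} {f : ℝ → ℝ} (hf : Function.Periodic f L) (m : ℕ) :
    Function.Periodic (iteratedDeriv m f) L := fun x => by
  rw [← congrFun (iteratedDeriv_comp_add_const m f L) x, funext hf]

theorem sobolevSeminorm_diffQuot_le (hab : a < b) {m : ℕ} {f : ℝ → ℝ} (hf : ContDiff ℝ m f)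
    (hper : Function.Periodic f (b - a)) (s : ℝ) :
    sobolevSeminorm a b m (diffQuot s f) ≤ 2 / |s| * sobolevSeminorm a b m f := by
  rw [sobolevSeminorm_eq_l2norm hab.le hf,
    sobolevSeminorm_eq_l2norm hab.le (contDiff_diffQuot hf s), iteratedDeriv_diffQuot hf]
  exact l2norm_diffQuot_le hab.le (mem_boundedPeriodic_of_continuous (sub_ne_zero.2 hab.ne')
    (hf.continuous_iteratedDeriv' m) (periodic_iteratedDeriv hper m)) s

/-! ### Meshes and piecewise polynomials -/

namespace Mesh

theorem left_lt_right (M : Mesh a b) (j : Fin M.N) : M.left j < M.right j :=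
  M.strictMono j.castSucc_lt_succ

theorem le_left (M : Mesh a b) (j : Fin M.N) : a ≤ M.left j :=
  M.node_zero.symm.trans_le (M.strictMono.monotone (Fin.zero_le _))

theorem right_le (M : Mesh a b) (j : Fin M.N) : M.right j ≤ b :=
  (M.strictMono.monotone (Fin.le_last _)).trans_eq M.node_last

theorem period_pos (M : Mesh a b) (j : Fin M.N) : 0 < b - a :=
  sub_pos.2 ((M.le_left j).trans_lt ((M.left_lt_right j).trans_le (M.right_le j)))

theorem cellLength_pos (M : Mesh a b) (j : Fin M.N) : 0 < M.cellLength j :=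
  sub_pos.2 (M.left_lt_right j)

theorem cellLength_le_size (M : Mesh a b) (j : Fin M.N) : M.cellLength j ≤ M.size :=
  le_ciSup (Set.finite_range M.cellLength).bddAbove j

theorem size_nonneg (M : Mesh a b) : 0 ≤ M.size :=
  Real.iSup_nonneg fun j => (M.cellLength_pos j).le

theorem right_le_left_of_lt (M : Mesh a b) {i j : Fin M.N} (hij : i < j) : M.right i ≤ M.left j :=
  M.strictMono.monotone (Fin.succ_le_castSucc_iff.2 hij)

theorem eq_of_mem_cells (M : Mesh a b) {i j : Fin M.N} {x : ℝ}
    (hi : x ∈ Ioo (M.left i) (M.right i)) (hj : x ∈ Ioo (M.left j) (M.right j)) : i = j := by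
  rcases lt_trichotomy i j with h | h | h
  · linarith [M.right_le_left_of_lt h, hi.2, hj.1]
  · exact h
  · linarith [M.right_le_left_of_lt h, hj.2, hi.1]

theorem exists_left_le_lt_right (M : Mesh a b) {x : ℝ} (hx : x ∈ Ico a b) :
    ∃ j, M.left j ≤ x ∧ x < M.right j := by
  suffices h : ∀ i : Fin (M.N + 1), x < M.node i → ∃ j, M.left j ≤ x ∧ x < M.right j from
    h (Fin.last _) (hx.2.trans_eq M.node_last.symm)
  intro i
  induction i using Fin.induction with
  | zero => exact fun h => absurd (h.trans_eq M.node_zero) hx.1.not_gt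
  | succ j ih => exact fun h => (lt_or_ge x (M.left j)).elim ih fun hj => ⟨j, hj, h⟩

theorem sum_integral_cells (M : Mesh a b) {f : ℝ → ℝ}
    (hf : ∀ l r, IntervalIntegrable f volume l r) :
    ∑ j, ∫ x in (M.left j)..(M.right j), f x = ∫ x in a..b, f x := by
  suffices h : ∀ n (hn : n < M.N + 1), ∑ j : Fin n,
      ∫ x in (M.node ⟨j, by omega⟩)..(M.node ⟨j + 1, by omega⟩), f x =
        ∫ x in a..(M.node ⟨n, hn⟩), f x by
    have hN := h M.N (Nat.lt_succ_self _)
    rwa [show M.node ⟨M.N, _⟩ = b from M.node_last] at hN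
  intro n hn
  induction n with
  | zero => simpa using (congrArg (fun c => ∫ x in a..c, f x) M.node_zero).symm
  | succ n ih =>
    rw [Fin.sum_univ_castSucc]
    simp only [Fin.val_castSucc, Fin.val_last]
    rw [ih (by omega), intervalIntegral.integral_add_adjacent_intervals (hf _ _) (hf _ _)]

theorem integral_cell_congr (M : Mesh a b) (j : Fin M.N) {f g : ℝ → ℝ}
    (h : ∀ x ∈ Ioo (M.left j) (M.right j), f x = g x) :
    ∫ x in (M.left j)..(M.right j), f x = ∫ x in (M.left j)..(M.right j), g x := by
  simp only [intervalIntegral.integral_of_le (M.left_lt_right j).le, integral_Ioc_eq_integral_Ioo]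
  exact setIntegral_congr_fun measurableSet_Ioo h

theorem ae_exists_toIcoMod_mem (M : Mesh a b) (hab : a < b) :
    ∀ᵐ x : ℝ, ∃ j, toIcoMod (sub_pos.2 hab) a x ∈ Ioo (M.left j) (M.right j) := by
  have hcount : (⋃ i : Fin (M.N + 1), ⋃ n : ℤ, {M.node i + n • (b - a)}).Countable :=
    countable_iUnion fun i => countable_iUnion fun n => countable_singleton _
  filter_upwards [hcount.ae_notMem volume] with x hx
  have hmem := toIcoMod_mem_Ico (sub_pos.2 hab) a x
  rw [add_sub_cancel] at hmem
  obtain ⟨j, hleft, hright⟩ := M.exists_left_le_lt_right hmem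
  refine ⟨j, hleft.lt_of_ne fun heq => hx ?_, hright⟩
  simp only [mem_iUnion, mem_singleton_iff]
  exact ⟨j.castSucc, toIcoDiv (sub_pos.2 hab) a x, by
    rw [show M.node j.castSucc = _ from heq, toIcoMod_add_toIcoDiv_zsmul]⟩

theorem ae_eq_of_eq_on_cells (M : Mesh a b) (hab : a < b) {v w : ℝ → ℝ}
    (hv : Function.Periodic v (b - a)) (hw : Function.Periodic w (b - a))
    (h : ∀ j, ∀ x ∈ Ioo (M.left j) (M.right j), v x = w x) : v =ᵐ[volume] w := by
  filter_upwards [M.ae_exists_toIcoMod_mem hab] with x ⟨j, hj⟩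
  have := h j _ hj
  rwa [toIcoMod, hv.sub_zsmul_eq, hw.sub_zsmul_eq] at this

/-- The `(b - a)`-periodic function equal to the polynomial `p` on the cell `I_j` and to zero on
all other cells and at the nodes. -/
def cellPoly (M : Mesh a b) (j : Fin M.N) (p : Polynomial ℝ) (x : ℝ) : ℝ :=
  (Ioo (M.left j) (M.right j)).indicator p.eval (toIcoMod (M.period_pos j) a x)

theorem cellPoly_apply (M : Mesh a b) {i : Fin M.N} {x : ℝ}
    (hx : x ∈ Ioo (M.left i) (M.right i)) (j : Fin M.N) (p : Polynomial ℝ) :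
    M.cellPoly j p x = if i = j then p.eval x else 0 := by
  have hmod : toIcoMod (M.period_pos j) a x = x := (toIcoMod_eq_self _).2
    ⟨(M.le_left i).trans hx.1.le, by linarith [hx.2, M.right_le i]⟩
  rw [cellPoly, hmod]
  split_ifs with hij
  · exact indicator_of_mem (hij ▸ hx) _
  · exact indicator_of_notMem (fun hj => hij (M.eq_of_mem_cells hx hj)) _

theorem periodic_cellPoly (M : Mesh a b) (j : Fin M.N) (p : Polynomial ℝ) :
    Function.Periodic (M.cellPoly j p) (b - a) := fun x => by
  simp only [cellPoly, toIcoMod_add_right]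

theorem cellPoly_mem_dgSpace (M : Mesh a b) (j : Fin M.N) {k : ℕ} {p : Polynomial ℝ}
    (hp : p.natDegree ≤ k) : M.cellPoly j p ∈ M.dgSpace k := by
  refine ⟨M.periodic_cellPoly j p, fun i => ?_⟩
  by_cases hij : i = j
  · exact ⟨p, hp, fun x hx => by rw [M.cellPoly_apply hx, if_pos hij]⟩
  · exact ⟨0, by simp, fun x hx => by rw [M.cellPoly_apply hx, if_neg hij, Polynomial.eval_zero]⟩

theorem cellPoly_mem_boundedPeriodic (M : Mesh a b) (j : Fin M.N) (p : Polynomial ℝ) :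
    M.cellPoly j p ∈ boundedPeriodic (b - a) := by
  obtain ⟨C, hC⟩ := isCompact_Icc.exists_bound_of_continuousOn (s := Icc (M.left j) (M.right j))
    p.continuous.continuousOn
  have hmod : Measurable (toIcoMod (M.period_pos j) a) := by
    rw [funext (toIcoMod_eq_add_fract_mul (M.period_pos j) a)]
    fun_prop
  refine ⟨M.periodic_cellPoly j p, memLp_top_of_bound
    ((p.continuous.measurable.indicator measurableSet_Ioo).comp hmod).aestronglyMeasurable C
    (Filter.Eventually.of_forall fun x => ?_)⟩
  rw [cellPoly, norm_indicator_eq_indicator_norm]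
  exact indicator_apply_le' (fun hx => hC _ (Ioo_subset_Icc_self hx)) fun _ =>
    (norm_nonneg _).trans (hC _ (left_mem_Icc.2 (M.left_lt_right j).le))

theorem sum_cellPoly_apply (M : Mesh a b) (p : Fin M.N → Polynomial ℝ) {i : Fin M.N} {x : ℝ}
    (hx : x ∈ Ioo (M.left i) (M.right i)) : (∑ j, M.cellPoly j (p j)) x = (p i).eval x := by
  simp [Finset.sum_apply, M.cellPoly_apply hx]

theorem dgSpace_le_boundedPeriodic (M : Mesh a b) (hab : a < b) (k : ℕ) :
    M.dgSpace k ≤ boundedPeriodic (b - a) := by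
  intro v hv
  choose p _ hvp using hv.2
  have hsum : ∑ j, M.cellPoly j (p j) ∈ boundedPeriodic (b - a) :=
    Submodule.sum_mem _ fun j _ => M.cellPoly_mem_boundedPeriodic j (p j)
  refine ⟨hv.1, (memLp_congr_ae ?_).1 hsum.2⟩
  exact M.ae_eq_of_eq_on_cells hab hsum.1 hv.1 fun j x hx => by
    rw [M.sum_cellPoly_apply p hx, hvp j x hx]

end Mesh

/-- The Taylor polynomial of degree `k` of `f` at `c`. -/
def taylorPoly (f : ℝ → ℝ) (k : ℕ) (c : ℝ) : Polynomial ℝ :=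
  ∑ i ∈ Finset.range (k + 1),
    Polynomial.C ((i.factorial : ℝ)⁻¹ * iteratedDeriv i f c) * (Polynomial.X - Polynomial.C c) ^ i

theorem natDegree_taylorPoly_le (f : ℝ → ℝ) (k : ℕ) (c : ℝ) : (taylorPoly f k c).natDegree ≤ k := by
  refine Polynomial.natDegree_sum_le_of_forall_le _ _ fun i hi => ?_
  calc _ ≤ ((Polynomial.X - Polynomial.C c) ^ i).natDegree := Polynomial.natDegree_C_mul_le _ _
    _ ≤ i * 1 := Polynomial.natDegree_pow_le_of_le i (Polynomial.natDegree_X_sub_C_le c)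
    _ ≤ k := by simpa [Nat.lt_succ_iff] using hi

theorem sub_eval_taylorPoly {f : ℝ → ℝ} {k : ℕ} (hf : ContDiff ℝ (k + 1 : ℕ) f) {c x : ℝ}
    (hcx : c < x) : f x - (taylorPoly f k c).eval x =
      ∫ y in c..x, ((x - y) ^ k / k.factorial) * iteratedDeriv (k + 1) f y := by
  have hderiv : ∀ i ≤ k + 1, ∀ y ∈ uIcc c x,
      iteratedDerivWithin i f (uIcc c x) y = iteratedDeriv i f y := fun i hi y hy =>
    iteratedDerivWithin_eq_iteratedDeriv (uniqueDiffOn_uIcc hcx.ne)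
      (hf.of_le (by exact_mod_cast hi)).contDiffAt hy
  have htaylor : taylorWithinEval f k (uIcc c x) c x = (taylorPoly f k c).eval x := by
    rw [taylor_within_apply, taylorPoly, Polynomial.eval_finsetSum]
    refine Finset.sum_congr rfl fun i hi => ?_
    rw [hderiv i (Finset.mem_range.1 hi).le c left_mem_uIcc]
    simp only [Polynomial.eval_mul, Polynomial.eval_C, Polynomial.eval_pow, Polynomial.eval_sub,
      Polynomial.eval_X, smul_eq_mul]
    ring
  rw [← htaylor, taylor_integral_remainder (n := k) hf.contDiffOn]
  refine intervalIntegral.integral_congr fun y hy => ?_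
  simp only [smul_eq_mul, hderiv _ le_rfl y hy]

theorem abs_sub_eval_taylorPoly_le {f : ℝ → ℝ} {k : ℕ} (hf : ContDiff ℝ (k + 1 : ℕ) f)
    {l r x : ℝ} (hx : x ∈ Ioc l r) : |f x - (taylorPoly f k l).eval x| ≤
      (r - l) ^ k * ∫ y in l..r, |iteratedDeriv (k + 1) f y| := by
  have hcont : Continuous (iteratedDeriv (k + 1) f) := hf.continuous_iteratedDeriv' (k + 1)
  have hweight : ∀ y ∈ Icc l x, |(x - y) ^ k / (k.factorial : ℝ)| ≤ (r - l) ^ k := fun y hy => by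
    have hxy : 0 ≤ x - y := sub_nonneg.2 hy.2
    rw [abs_of_nonneg (by positivity)]
    exact (div_le_self (by positivity) (by exact_mod_cast k.factorial_pos)).trans
      (pow_le_pow_left₀ hxy (sub_le_sub hx.2 hy.1) k)
  rw [sub_eval_taylorPoly hf hx.1, ← intervalIntegral.integral_const_mul]
  calc _ ≤ ∫ y in l..x, |((x - y) ^ k / k.factorial) * iteratedDeriv (k + 1) f y| :=
        intervalIntegral.abs_integral_le_integral_abs hx.1.le
    _ ≤ ∫ y in l..x, (r - l) ^ k * |iteratedDeriv (k + 1) f y| :=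
        intervalIntegral.integral_mono_on hx.1.le
          (Continuous.intervalIntegrable (by fun_prop) _ _)
          ((continuous_const.mul hcont.abs).intervalIntegrable _ _) fun y hy => by
            rw [abs_mul]
            exact mul_le_mul_of_nonneg_right (hweight y hy) (abs_nonneg _)
    _ ≤ _ := intervalIntegral.integral_mono_interval le_rfl hx.1.le hx.2
        (Filter.Eventually.of_forall fun y =>
          mul_nonneg (pow_nonneg (sub_nonneg.2 (hx.1.le.trans hx.2)) k) (abs_nonneg _))
        ((continuous_const.mul hcont.abs).intervalIntegrable _ _)

theorem sq_integral_abs_le {l r : ℝ} (hlr : l ≤ r) {g : ℝ → ℝ}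
    (hg : MemLp g 2 (volume.restrict (Ioc l r))) :
    (∫ x in l..r, |g x|) ^ 2 ≤ (r - l) * ∫ x in l..r, g x ^ 2 := by
  have hcs := abs_integral_mul_le_lpNorm_mul_lpNorm (memLp_const (1 : ℝ)) hg.abs
  rw [← sq_le_sq₀ (abs_nonneg _) (mul_nonneg lpNorm_nonneg lpNorm_nonneg), mul_pow,
    sq_lpNorm_two aestronglyMeasurable_const, sq_lpNorm_two hg.abs.1] at hcs
  simpa [intervalIntegral.integral_of_le hlr, hlr] using hcs

theorem integral_sub_taylorPoly_sq_le {f : ℝ → ℝ} {k : ℕ} (hf : ContDiff ℝ (k + 1 : ℕ) f)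
    {l r : ℝ} (hlr : l ≤ r) :
    ∫ x in l..r, (f x - (taylorPoly f k l).eval x) ^ 2 ≤
      (r - l) ^ (2 * k + 2) * ∫ x in l..r, iteratedDeriv (k + 1) f x ^ 2 := by
  have hcont : Continuous (iteratedDeriv (k + 1) f) := hf.continuous_iteratedDeriv' (k + 1)
  have hL2 : MemLp (iteratedDeriv (k + 1) f) 2 (volume.restrict (Ioc l r)) :=
    (memLp_two_iff_integrable_sq hcont.aestronglyMeasurable).2
      ((hcont.pow 2).integrableOn_Ioc (a := l) (b := r))
  calc _ ≤ ∫ _ in l..r, ((r - l) ^ k * ∫ y in l..r, |iteratedDeriv (k + 1) f y|) ^ 2 := by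
        refine intervalIntegral.integral_mono_on_of_le_Ioo hlr ?_ intervalIntegrable_const
          fun x hx => sq_le_sq' ?_ ?_
        · exact ((hf.continuous.sub (taylorPoly f k l).continuous).pow 2).intervalIntegrable _ _
        all_goals
          have := abs_le.1 (abs_sub_eval_taylorPoly_le hf (Ioo_subset_Ioc_self hx))
          linarith
    _ = (r - l) ^ (2 * k + 1) * (∫ y in l..r, |iteratedDeriv (k + 1) f y|) ^ 2 := by
        rw [intervalIntegral.integral_const, smul_eq_mul]
        ring
    _ ≤ (r - l) ^ (2 * k + 1) * ((r - l) * ∫ x in l..r, iteratedDeriv (k + 1) f x ^ 2) :=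
        mul_le_mul_of_nonneg_left (sq_integral_abs_le hlr hL2)
          (pow_nonneg (sub_nonneg.2 hlr) _)
    _ = _ := by ring

theorem Mesh.exists_mem_dgSpace_l2norm_sub_le (M : Mesh a b) (hab : a < b) {k : ℕ} {f : ℝ → ℝ}
    (hf : ContDiff ℝ (k + 1 : ℕ) f) (hper : Function.Periodic f (b - a)) :
    ∃ v ∈ M.dgSpace k,
      l2norm a b (f - v) ≤ M.size ^ (k + 1) * sobolevSeminorm a b (k + 1) f := by
  let v : ℝ → ℝ := ∑ j, M.cellPoly j (taylorPoly f k (M.left j))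
  have hv : v ∈ M.dgSpace k := Submodule.sum_mem _ fun j _ =>
    M.cellPoly_mem_dgSpace j (natDegree_taylorPoly_le f k _)
  have hL : b - a ≠ 0 := sub_ne_zero.2 hab.ne'
  have hdiff : f - v ∈ boundedPeriodic (b - a) := Submodule.sub_mem _
    (mem_boundedPeriodic_of_continuous hL hf.continuous hper)
    (M.dgSpace_le_boundedPeriodic hab k hv)
  have hcont : Continuous (iteratedDeriv (k + 1) f) := hf.continuous_iteratedDeriv' (k + 1)
  refine ⟨v, hv, le_of_sq_le_sq ?_ (mul_nonneg (pow_nonneg M.size_nonneg _) (Real.sqrt_nonneg _))⟩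
  rw [sobolevSeminorm_eq_l2norm hab.le hf, mul_pow, sq_l2norm hab.le hcont.aestronglyMeasurable,
    sq_l2norm hab.le (memLp_two_of_mem_boundedPeriodic hdiff a b).1,
    ← M.sum_integral_cells (f := fun x => (f - v) x ^ 2) (fun l r => by
      simpa only [pow_two] using intervalIntegrable_mul_of_mem_boundedPeriodic hdiff hdiff l r),
    ← M.sum_integral_cells (f := fun x => iteratedDeriv (k + 1) f x ^ 2)
      (fun l r => (hcont.pow 2).intervalIntegrable l r), Finset.mul_sum]
  refine Finset.sum_le_sum fun j _ => ?_
  rw [M.integral_cell_congr j (g := fun x => (f x - (taylorPoly f k (M.left j)).eval x) ^ 2)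
    fun x hx => by simp only [Pi.sub_apply, v, M.sum_cellPoly_apply _ hx],
    ← pow_mul, add_mul, mul_comm k]
  refine (integral_sub_taylorPoly_sq_le hf (M.left_lt_right j).le).trans
    (mul_le_mul_of_nonneg_right ?_ ?_)
  · exact pow_le_pow_left₀ (M.cellLength_pos j).le (M.cellLength_le_size j) _
  · exact intervalIntegral.integral_nonneg (M.left_lt_right j).le fun _ _ => sq_nonneg _

theorem diffQuot_congr_ae {v w : ℝ → ℝ} (h : v =ᵐ[volume] w) (s : ℝ) :
    diffQuot s v =ᵐ[volume] diffQuot s w := by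
  filter_upwards [h, (measurePreserving_add_right volume s).quasiMeasurePreserving.ae_eq_comp h]
    with x hx hxs
  simp only [Function.comp_apply] at hxs
  rw [diffQuot_apply, diffQuot_apply, hx, hxs]

theorem integral_congr_ae_mul {v w : ℝ → ℝ} (h : v =ᵐ[volume] w) (φ : ℝ → ℝ) (l r : ℝ) :
    ∫ x in l..r, v x * φ x = ∫ x in l..r, w x * φ x :=
  intervalIntegral.integral_congr_ae (h.mono fun x hx _ => by rw [hx])

theorem integral_sum_smul_mul {ι : Type*} [Fintype ι] {L : ℝ} (c : ι → ℝ) {f : ι → ℝ → ℝ}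
    (hf : ∀ i, f i ∈ boundedPeriodic L) {φ : ℝ → ℝ} (hφ : φ ∈ boundedPeriodic L) (l r : ℝ) :
    ∫ x in l..r, (∑ i, c i • f i) x * φ x = ∑ i, c i * ∫ x in l..r, f i x * φ x := by
  simp only [Finset.sum_apply, Pi.smul_apply, smul_eq_mul, Finset.sum_mul, mul_assoc]
  rw [intervalIntegral.integral_finsetSum fun i _ =>
    (intervalIntegrable_mul_of_mem_boundedPeriodic (hf i) hφ l r).const_mul (c i)]
  simp only [intervalIntegral.integral_const_mul]

namespace Mesh

variable {k : ℕ}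

/-- The interpolation nodes: `k + 1` distinct points in every open cell. Their position is
immaterial. -/
def interpNode (M : Mesh a b) (m : Fin M.N × Fin (k + 1)) : ℝ :=
  (Ioo_infinite (M.left_lt_right m.1)).natEmbedding _ m.2

theorem interpNode_mem (M : Mesh a b) (m : Fin M.N × Fin (k + 1)) :
    M.interpNode m ∈ Ioo (M.left m.1) (M.right m.1) :=
  ((Ioo_infinite (M.left_lt_right m.1)).natEmbedding _ m.2).2

theorem injective_interpNode (M : Mesh a b) (j : Fin M.N) :
    Function.Injective fun i : Fin (k + 1) => M.interpNode (j, i) := fun _ _ h =>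
  Fin.ext ((Ioo_infinite (M.left_lt_right j)).natEmbedding _ |>.injective (Subtype.ext h))

/-- The basis of `V_h^k` dual to the point values at the interpolation nodes. -/
def nodalBasis (M : Mesh a b) (m : Fin M.N × Fin (k + 1)) : ℝ → ℝ :=
  M.cellPoly m.1 (Lagrange.basis Finset.univ (fun i => M.interpNode (m.1, i)) m.2)

theorem nodalBasis_mem_dgSpace (M : Mesh a b) (m : Fin M.N × Fin (k + 1)) :
    M.nodalBasis m ∈ M.dgSpace k :=
  M.cellPoly_mem_dgSpace m.1
    (by simp [Lagrange.natDegree_basis (M.injective_interpNode m.1).injOn (Finset.mem_univ m.2)])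

theorem nodalBasis_mem_boundedPeriodic (M : Mesh a b) (m : Fin M.N × Fin (k + 1)) :
    M.nodalBasis m ∈ boundedPeriodic (b - a) :=
  M.cellPoly_mem_boundedPeriodic m.1 _

theorem nodalBasis_interpNode (M : Mesh a b) (m n : Fin M.N × Fin (k + 1)) :
    M.nodalBasis m (M.interpNode n) = if m = n then 1 else 0 := by
  obtain ⟨j, i⟩ := m
  obtain ⟨j', i'⟩ := n
  rw [nodalBasis, M.cellPoly_apply (M.interpNode_mem (j', i'))]
  by_cases hj : j' = j
  · subst hj
    by_cases hi : i = i'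
    · simp [hi, Lagrange.eval_basis_self (M.injective_interpNode j').injOn]
    · simpa [hi] using Lagrange.eval_basis_of_ne (v := fun i => M.interpNode (j', i)) hi
        (Finset.mem_univ i')
  · rw [if_neg hj, if_neg fun h => hj (congrArg Prod.fst h).symm]

theorem sum_nodalBasis_apply (M : Mesh a b) {v : ℝ → ℝ} (hv : v ∈ M.dgSpace k) {j : Fin M.N}
    {x : ℝ} (hx : x ∈ Ioo (M.left j) (M.right j)) :
    v x = ∑ m : Fin M.N × Fin (k + 1), v (M.interpNode m) * M.nodalBasis m x := by
  obtain ⟨p, hp, hvp⟩ := hv.2 j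
  have hdeg : p.degree < (Finset.univ : Finset (Fin (k + 1))).card := by
    rw [Finset.card_fin]
    exact Polynomial.degree_le_natDegree.trans_lt (by exact_mod_cast Nat.lt_succ_of_le hp)
  have hinterp := congrArg (Polynomial.eval x)
    (Lagrange.eq_interpolate (M.injective_interpNode j).injOn hdeg)
  simp only [Lagrange.interpolate_apply, Polynomial.eval_finsetSum, Polynomial.eval_mul,
    Polynomial.eval_C] at hinterp
  rw [hvp x hx, hinterp, Fintype.sum_prod_type, Finset.sum_eq_single j]
  · exact Finset.sum_congr rfl fun i _ => by
      rw [nodalBasis, M.cellPoly_apply hx, if_pos rfl, hvp _ (M.interpNode_mem (j, i))]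
  · exact fun i _ hij => Finset.sum_eq_zero fun n _ => by
      rw [nodalBasis, M.cellPoly_apply hx, if_neg hij.symm, mul_zero]
  · exact fun hj => absurd (Finset.mem_univ j) hj

theorem sum_smul_nodalBasis_mem_dgSpace (M : Mesh a b) (c : Fin M.N × Fin (k + 1) → ℝ) :
    ∑ m, c m • M.nodalBasis m ∈ M.dgSpace k :=
  Submodule.sum_mem _ fun m _ => Submodule.smul_mem _ _ (M.nodalBasis_mem_dgSpace m)

theorem ae_eq_sum_nodalBasis (M : Mesh a b) (hab : a < b) {v : ℝ → ℝ} (hv : v ∈ M.dgSpace k) :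
    v =ᵐ[volume] ∑ m : Fin M.N × Fin (k + 1), v (M.interpNode m) • M.nodalBasis m :=
  M.ae_eq_of_eq_on_cells hab hv.1 (M.sum_smul_nodalBasis_mem_dgSpace _).1 fun j x hx => by
    simp only [Finset.sum_apply, Pi.smul_apply, smul_eq_mul]
    exact M.sum_nodalBasis_apply hv hx

theorem integral_mul_eq_sum_nodalBasis (M : Mesh a b) (hab : a < b) {v φ : ℝ → ℝ}
    (hv : v ∈ M.dgSpace k) (hφ : φ ∈ boundedPeriodic (b - a)) (l r : ℝ) :
    ∫ x in l..r, v x * φ x = ∑ m : Fin M.N × Fin (k + 1),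
      v (M.interpNode m) * ∫ x in l..r, M.nodalBasis m x * φ x := by
  rw [integral_congr_ae_mul (M.ae_eq_sum_nodalBasis hab hv),
    integral_sum_smul_mul _ M.nodalBasis_mem_boundedPeriodic hφ]

theorem integral_diffQuot_mul_eq_sum_nodalBasis (M : Mesh a b) (hab : a < b) {v φ : ℝ → ℝ}
    (hv : v ∈ M.dgSpace k) (hφ : φ ∈ boundedPeriodic (b - a)) (s l r : ℝ) :
    ∫ x in l..r, diffQuot s v x * φ x = ∑ m : Fin M.N × Fin (k + 1),
      v (M.interpNode m) * ∫ x in l..r, diffQuot s (M.nodalBasis m) x * φ x := by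
  rw [integral_congr_ae_mul (diffQuot_congr_ae (M.ae_eq_sum_nodalBasis hab hv) s), map_sum]
  simp only [map_smul]
  exact integral_sum_smul_mul _
    (fun m => diffQuot_mem_boundedPeriodic (M.nodalBasis_mem_boundedPeriodic m) s) hφ l r

theorem eq_zero_of_integral_mul_self_eq_zero (M : Mesh a b) (hab : a < b) {v : ℝ → ℝ}
    (hv : v ∈ M.dgSpace k) (h0 : ∫ x in a..b, v x * v x = 0) {j : Fin M.N} {x : ℝ}
    (hx : x ∈ Ioo (M.left j) (M.right j)) : v x = 0 := by
  have hL2 := memLp_two_of_mem_boundedPeriodic (M.dgSpace_le_boundedPeriodic hab k hv) a b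
  have hnorm : l2norm a b v = 0 := by
    rw [← sq_eq_zero_iff, sq_l2norm hab.le hL2.1, ← h0]
    simp only [pow_two]
  have hae : v =ᵐ[volume.restrict (Ioc a b)] 0 := (lpNorm_eq_zero hL2 two_ne_zero).1 hnorm
  have hcell : Ioo (M.left j) (M.right j) ⊆ Ioc a b :=
    (Ioo_subset_Ioc_self).trans (Ioc_subset_Ioc (M.le_left j) (M.right_le j))
  obtain ⟨p, -, hvp⟩ := hv.2 j
  exact Measure.eqOn_open_of_ae_eq (ae_restrict_of_ae_restrict_of_subset hcell hae) isOpen_Ioo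
    (p.continuous.continuousOn.congr hvp) continuousOn_const hx

theorem exists_linearMap_moments (M : Mesh a b) (hab : a < b) (k : ℕ) :
    ∃ g : (Fin M.N × Fin (k + 1) → ℝ) →ₗ[ℝ] (Fin M.N × Fin (k + 1) → ℝ), ∀ v ∈ M.dgSpace k,
      g (fun n => ∫ x in a..b, v x * M.nodalBasis n x) = fun m => v (M.interpNode m) := by
  let G : (Fin M.N × Fin (k + 1) → ℝ) →ₗ[ℝ] (Fin M.N × Fin (k + 1) → ℝ) :=
    Matrix.mulVecLin (.of fun n m => ∫ x in a..b, M.nodalBasis m x * M.nodalBasis n x)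
  have hG : ∀ v ∈ M.dgSpace k, G (fun m => v (M.interpNode m)) =
      fun n => ∫ x in a..b, v x * M.nodalBasis n x := fun v hv => by
    ext n
    rw [M.integral_mul_eq_sum_nodalBasis hab hv (M.nodalBasis_mem_boundedPeriodic n)]
    simp [G, Matrix.mulVec, dotProduct, mul_comm]
  have hker : LinearMap.ker G = ⊥ := (LinearMap.ker_eq_bot').2 fun c hc => by
    let v : ℝ → ℝ := ∑ m, c m • M.nodalBasis m
    have hv : v ∈ M.dgSpace k := M.sum_smul_nodalBasis_mem_dgSpace c
    have hvc : (fun m => v (M.interpNode m)) = c := by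
      ext m
      simp [v, M.nodalBasis_interpNode]
    have horth : ∀ n, ∫ x in a..b, v x * M.nodalBasis n x = 0 := fun n => by
      rw [← congrFun (hG v hv) n, hvc, hc, Pi.zero_apply]
    have hself : ∫ x in a..b, v x * v x = 0 := by
      rw [M.integral_mul_eq_sum_nodalBasis hab hv (M.dgSpace_le_boundedPeriodic hab k hv)]
      exact Finset.sum_eq_zero fun n _ => by
        simp only [mul_comm (M.nodalBasis n _), horth, mul_zero]
    rw [← hvc]
    exact funext fun m => M.eq_zero_of_integral_mul_self_eq_zero hab hv hself (M.interpNode_mem m)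
  obtain ⟨g, hg⟩ := G.exists_leftInverse_of_injective hker
  exact ⟨g, fun v hv => by rw [← hG v hv, ← LinearMap.comp_apply, hg, LinearMap.id_apply]⟩

end Mesh

theorem periodic_timeDeriv {L T : ℝ} {w : ℝ → ℝ → ℝ}
    (hper : ∀ t ∈ Icc 0 T, Function.Periodic (w t) L) {t : ℝ} (ht : t ∈ Icc 0 T) :
    Function.Periodic (timeDeriv T w t) L := fun x =>
  derivWithin_congr (fun r hr => hper r hr x) (hper t ht x)

namespace Mesh

variable {k : ℕ}

theorem mem_dgSpace_of_eq_on_cells (M : Mesh a b) {v w : ℝ → ℝ} (hw : w ∈ M.dgSpace k)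
    (hper : Function.Periodic v (b - a))
    (h : ∀ j, ∀ x ∈ Ioo (M.left j) (M.right j), v x = w x) : v ∈ M.dgSpace k := by
  refine ⟨hper, fun j => ?_⟩
  obtain ⟨p, hp, hwp⟩ := hw.2 j
  exact ⟨p, hp, fun x hx => (h j x hx).trans (hwp x hx)⟩

theorem timeDeriv_mem_dgSpace (M : Mesh a b) {T : ℝ} {w : ℝ → ℝ → ℝ}
    (hw : ∀ t ∈ Icc 0 T, w t ∈ M.dgSpace k)
    (hdiff : ∀ j, ∀ x ∈ Ioo (M.left j) (M.right j), DifferentiableOn ℝ (fun t => w t x) (Icc 0 T))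
    {t : ℝ} (ht : t ∈ Icc 0 T) : timeDeriv T w t ∈ M.dgSpace k := by
  refine M.mem_dgSpace_of_eq_on_cells
    (M.sum_smul_nodalBasis_mem_dgSpace fun m => timeDeriv T w t (M.interpNode m))
    (periodic_timeDeriv (fun r hr => (hw r hr).1) ht) fun j x hx => ?_
  have hexpand : EqOn (fun r => w r x) (fun r => ∑ m : Fin M.N × Fin (k + 1),
      w r (M.interpNode m) * M.nodalBasis m x) (Icc 0 T) :=
    fun r hr => M.sum_nodalBasis_apply (hw r hr) hx
  have hnode : ∀ m : Fin M.N × Fin (k + 1),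
      DifferentiableWithinAt ℝ (fun r => w r (M.interpNode m)) (Icc 0 T) t :=
    fun m => hdiff m.1 _ (M.interpNode_mem m) t ht
  simp only [timeDeriv, Finset.sum_apply, Pi.smul_apply, smul_eq_mul]
  rw [derivWithin_congr hexpand (hexpand ht),
    derivWithin_fun_sum fun m _ => (hnode m).mul_const _]
  exact Finset.sum_congr rfl fun m _ => derivWithin_mul_const (hnode m) _

theorem hasDerivWithinAt_integral_mul (M : Mesh a b) (hab : a < b) {T : ℝ} {w : ℝ → ℝ → ℝ}
    (hw : ∀ t ∈ Icc 0 T, w t ∈ M.dgSpace k)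
    (hdiff : ∀ j, ∀ x ∈ Ioo (M.left j) (M.right j), DifferentiableOn ℝ (fun t => w t x) (Icc 0 T))
    {φ : ℝ → ℝ} (hφ : φ ∈ boundedPeriodic (b - a)) {t : ℝ} (ht : t ∈ Icc 0 T) :
    HasDerivWithinAt (fun r => ∫ x in a..b, w r x * φ x) (∫ x in a..b, timeDeriv T w t x * φ x)
      (Icc 0 T) t := by
  have hexpand := fun r (hr : r ∈ Icc 0 T) =>
    M.integral_mul_eq_sum_nodalBasis hab (hw r hr) hφ a b
  rw [M.integral_mul_eq_sum_nodalBasis hab (M.timeDeriv_mem_dgSpace hw hdiff ht) hφ]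
  refine HasDerivWithinAt.congr (HasDerivWithinAt.fun_sum fun m _ => ?_) hexpand (hexpand t ht)
  exact ((hdiff m.1 _ (M.interpNode_mem m) t ht).hasDerivWithinAt).mul_const _

end Mesh

theorem aestronglyMeasurable_comp_add {v : ℝ → ℝ} (hv : AEStronglyMeasurable v volume) :
    AEStronglyMeasurable (fun p : ℝ × ℝ => v (p.2 + p.1)) (volume.prod volume) := by
  simpa only [Function.comp_def, add_comm] using
    hv.comp_quasiMeasurePreserving (Measure.quasiMeasurePreserving_snd.comp
      (measurePreserving_prod_add (volume : Measure ℝ) (volume : Measure ℝ)).quasiMeasurePreserving)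

theorem aestronglyMeasurable_integral_diffQuot_mul {L : ℝ} {v φ : ℝ → ℝ}
    (hv : v ∈ boundedPeriodic L) (hφ : φ ∈ boundedPeriodic L) (l r : ℝ) :
    AEStronglyMeasurable (fun s => ∫ x in l..r, diffQuot s v x * φ x) volume := by
  have hjoint : AEStronglyMeasurable
      (fun p : ℝ × ℝ => 1 / p.1 * (v (p.2 + p.1) - v p.2) * φ p.2) (volume.prod volume) :=
    ((measurable_fst.const_div 1).aestronglyMeasurable.mul
      ((aestronglyMeasurable_comp_add hv.2.1).sub hv.2.1.comp_snd)).mul hφ.2.1.comp_snd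
  have hslice : ∀ l r : ℝ, AEStronglyMeasurable
      (fun s => ∫ x in Ioc l r, 1 / s * (v (x + s) - v x) * φ x) volume := fun l r =>
    (hjoint.mono_measure (Measure.prod_mono le_rfl Measure.restrict_le_self)).integral_prod_right'
  simp only [diffQuot_apply, intervalIntegral]
  exact (hslice l r).sub (hslice r l)

theorem abs_integral_diffQuot_mul_le {l r : ℝ} (hal : a ≤ l) (hlr : l ≤ r) (hrb : r ≤ b)
    {v φ : ℝ → ℝ} (hv : v ∈ boundedPeriodic (b - a)) (hφ : φ ∈ boundedPeriodic (b - a)) (s : ℝ) :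
    |∫ x in l..r, diffQuot s v x * φ x| ≤ 2 / |s| * l2norm a b v * l2norm a b φ :=
  (abs_integral_mul_le_l2norm_mul hal hlr hrb (diffQuot_mem_boundedPeriodic hv s) hφ).trans
    (mul_le_mul_of_nonneg_right (l2norm_diffQuot_le (hal.trans (hlr.trans hrb)) hv s)
      lpNorm_nonneg)

section Kernel

variable {δ C : ℝ} {γ F : ℝ → ℝ}

theorem ae_norm_sq_mul_kernel_mul_le (hF : ∀ s ∈ Ioc 0 δ, |F s| ≤ C / s ^ 2) :
    ∀ᵐ s, s ∈ Ioc 0 δ → ‖s ^ 2 * γ s * F s‖ ≤ C * |γ s| := by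
  refine Filter.Eventually.of_forall fun s hs => ?_
  have hs2 : 0 < s ^ 2 := pow_pos hs.1 2
  calc ‖s ^ 2 * γ s * F s‖ = s ^ 2 * |γ s| * |F s| := by
        rw [norm_mul, norm_mul, Real.norm_of_nonneg hs2.le, Real.norm_eq_abs, Real.norm_eq_abs]
    _ ≤ s ^ 2 * |γ s| * (C / s ^ 2) := by gcongr; exact hF s hs
    _ = C * |γ s| := by rw [mul_right_comm, mul_div_cancel₀ C hs2.ne']

theorem intervalIntegrable_sq_mul_kernel_mul (hδ : 0 ≤ δ) (hγ : IntervalIntegrable γ volume 0 δ)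
    (hFm : AEStronglyMeasurable F (volume.restrict (Ioc 0 δ)))
    (hF : ∀ s ∈ Ioc 0 δ, |F s| ≤ C / s ^ 2) :
    IntervalIntegrable (fun s => s ^ 2 * γ s * F s) volume 0 δ := by
  refine (hγ.abs.const_mul C).mono_fun' ?_ ?_
  · rw [uIoc_of_le hδ]
    exact ((continuous_pow 2).aestronglyMeasurable.mul hγ.1.1).mul hFm
  · rw [uIoc_of_le hδ]
    exact (ae_restrict_iff' measurableSet_Ioc).2 (ae_norm_sq_mul_kernel_mul_le hF)

theorem abs_integral_sq_mul_kernel_mul_le (hδ : 0 ≤ δ) (hγ : IntervalIntegrable γ volume 0 δ)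
    (hF : ∀ s ∈ Ioc 0 δ, |F s| ≤ C / s ^ 2) :
    |∫ s in 0..δ, s ^ 2 * γ s * F s| ≤ C * ∫ s in 0..δ, |γ s| := by
  rw [← intervalIntegral.integral_const_mul]
  exact intervalIntegral.norm_integral_le_of_norm_le hδ (ae_norm_sq_mul_kernel_mul_le hF)
    (hγ.abs.const_mul C)

end Kernel

/-! ### The semi-discrete scheme -/

namespace Mesh.IsDGSolution

variable {M : Mesh a b} {k : ℕ} {T δ : ℝ} {γ : ℝ → ℝ} {uh : ℝ → ℝ → ℝ} {qh : ℝ → ℝ → ℝ → ℝ}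
  {t s : ℝ} {φ : ℝ → ℝ}

theorem integral_qh_mul (hsol : M.IsDGSolution k T δ γ uh qh) (hab : a < b) (ht : t ∈ Icc 0 T)
    (hs : s ∈ Ioc 0 δ) (hφ : φ ∈ M.dgSpace k) :
    ∫ x in a..b, qh t s x * φ x = ∫ x in a..b, diffQuot s (uh t) x * φ x := by
  have hbdd := M.dgSpace_le_boundedPeriodic hab k
  rw [← M.sum_integral_cells (intervalIntegrable_mul_of_mem_boundedPeriodic
      (hbdd (hsol.mem_qh t ht s hs)) (hbdd hφ)),
    ← M.sum_integral_cells (intervalIntegrable_mul_of_mem_boundedPeriodic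
      (diffQuot_mem_boundedPeriodic (hbdd (hsol.mem_uh t ht)) s) (hbdd hφ))]
  refine Finset.sum_congr rfl fun j _ => ?_
  simpa only [opH, diffQuot_apply] using sub_eq_zero.1 (hsol.grad_eq t ht s hs φ hφ j)

theorem l2norm_qh_sub_le (hsol : M.IsDGSolution k T δ γ uh qh) (hab : a < b) (ht : t ∈ Icc 0 T)
    (hs : s ∈ Ioc 0 δ) {v : ℝ → ℝ} (hv : v ∈ M.dgSpace k) :
    l2norm a b (qh t s - v) ≤ l2norm a b (diffQuot s (uh t) - v) := by
  have hbdd := M.dgSpace_le_boundedPeriodic hab k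
  have hqv : qh t s - v ∈ M.dgSpace k := Submodule.sub_mem _ (hsol.mem_qh t ht s hs) hv
  have hDu := diffQuot_mem_boundedPeriodic (hbdd (hsol.mem_uh t ht)) s
  have horth : ∫ x in a..b, (diffQuot s (uh t) - qh t s) x * (qh t s - v) x = 0 := by
    rw [integral_sub_mul_of_mem_boundedPeriodic hDu (hbdd (hsol.mem_qh t ht s hs)) (hbdd hqv),
      hsol.integral_qh_mul hab ht hs hqv, sub_self]
  rw [intervalIntegral.integral_of_le hab.le] at horth
  refine lpNorm_le_of_integral_sub_mul_self_eq_zero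
    (memLp_two_of_mem_boundedPeriodic (Submodule.sub_mem _ hDu (hbdd hv)) a b)
    (memLp_two_of_mem_boundedPeriodic (hbdd hqv) a b) ?_
  simpa only [Pi.sub_apply, sub_sub_sub_cancel_right] using horth

theorem l2norm_qh_le (hsol : M.IsDGSolution k T δ γ uh qh) (hab : a < b) (ht : t ∈ Icc 0 T)
    (hs : s ∈ Ioc 0 δ) : l2norm a b (qh t s) ≤ 2 / s * l2norm a b (uh t) := by
  have hproj := hsol.l2norm_qh_sub_le hab ht hs (Submodule.zero_mem _)
  rw [sub_zero, sub_zero] at hproj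
  have hquot := l2norm_diffQuot_le hab.le
    (M.dgSpace_le_boundedPeriodic hab k (hsol.mem_uh t ht)) s
  exact hproj.trans (by rwa [abs_of_pos hs.1] at hquot)

theorem l2norm_qh_sub_diffQuot_le (hsol : M.IsDGSolution k T δ γ uh qh) (hab : a < b)
    (ht : t ∈ Icc 0 T) (hs : s ∈ Ioc 0 δ) {f : ℝ → ℝ} (hf : ContDiff ℝ (k + 1 : ℕ) f)
    (hper : Function.Periodic f (b - a)) :
    l2norm a b (qh t s - diffQuot s f) ≤
      2 / s * (l2norm a b (uh t - f) + 2 * (M.size ^ (k + 1) * sobolevSeminorm a b (k + 1) f)) := by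
  have hbdd := M.dgSpace_le_boundedPeriodic hab k
  have hfb := mem_boundedPeriodic_of_continuous (sub_ne_zero.2 hab.ne') hf.continuous hper
  have hDf := diffQuot_mem_boundedPeriodic hfb s
  obtain ⟨v, hv, happrox⟩ := M.exists_mem_dgSpace_l2norm_sub_le hab (contDiff_diffQuot hf s)
    fun x => (diffQuot_mem_boundedPeriodic hfb s).1 x
  have happrox' : l2norm a b (diffQuot s f - v) ≤
      M.size ^ (k + 1) * (2 / s * sobolevSeminorm a b (k + 1) f) := by
    refine happrox.trans (mul_le_mul_of_nonneg_left ?_ (pow_nonneg M.size_nonneg _))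
    simpa only [abs_of_pos hs.1] using sobolevSeminorm_diffQuot_le hab hf hper s
  have herror : l2norm a b (diffQuot s (uh t) - diffQuot s f) ≤ 2 / s * l2norm a b (uh t - f) := by
    simpa only [map_sub, abs_of_pos hs.1] using
      l2norm_diffQuot_le hab.le (Submodule.sub_mem _ (hbdd (hsol.mem_uh t ht)) hfb) s
  have hL2 := fun {w} (hw : w ∈ boundedPeriodic (b - a)) => memLp_two_of_mem_boundedPeriodic hw a b
  calc l2norm a b (qh t s - diffQuot s f)
      ≤ l2norm a b (qh t s - v) + l2norm a b (v - diffQuot s f) :=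
        lpNorm_sub_le_lpNorm_sub_add_lpNorm_sub (hL2 (hbdd (hsol.mem_qh t ht s hs)))
          (hL2 (hbdd hv)) one_le_two
    _ ≤ l2norm a b (diffQuot s (uh t) - diffQuot s f) + l2norm a b (diffQuot s f - v)
          + l2norm a b (diffQuot s f - v) := by
        refine add_le_add ((hsol.l2norm_qh_sub_le hab ht hs hv).trans ?_)
          (lpNorm_sub_comm _ _ _ _).le
        exact lpNorm_sub_le_lpNorm_sub_add_lpNorm_sub
          (hL2 (diffQuot_mem_boundedPeriodic (hbdd (hsol.mem_uh t ht)) s)) (hL2 hDf) one_le_two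
    _ ≤ _ := by linarith

/- The scheme prescribes no regularity of `q_h` in `s`: measurability is inherited from the moments
of `q_h(·,t;s)`, which are those of `D_s u_h` and determine the nodal values linearly. -/
theorem aestronglyMeasurable_qh_interpNode (hsol : M.IsDGSolution k T δ γ uh qh) (hab : a < b)
    (ht : t ∈ Icc 0 T) (m : Fin M.N × Fin (k + 1)) :
    AEStronglyMeasurable (fun s => qh t s (M.interpNode m)) (volume.restrict (Ioc 0 δ)) := by
  obtain ⟨g, hg⟩ := M.exists_linearMap_moments hab k
  have hmoments : AEStronglyMeasurable
      (fun s (n : Fin M.N × Fin (k + 1)) => ∫ x in a..b, diffQuot s (uh t) x * M.nodalBasis n x)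
      (volume.restrict (Ioc 0 δ)) :=
    (aemeasurable_pi_lambda _ fun n => (aestronglyMeasurable_integral_diffQuot_mul
      (M.dgSpace_le_boundedPeriodic hab k (hsol.mem_uh t ht))
      (M.nodalBasis_mem_boundedPeriodic n) a b).restrict.aemeasurable).aestronglyMeasurable
  refine (((continuous_apply m).comp g.continuous_of_finiteDimensional).comp_aestronglyMeasurable
    hmoments).congr ((ae_restrict_iff' measurableSet_Ioc).2 (.of_forall fun s hs => ?_))
  simp only [Function.comp_apply,
    ← hsol.integral_qh_mul hab ht hs (M.nodalBasis_mem_dgSpace _), hg _ (hsol.mem_qh t ht s hs)]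

theorem intervalIntegrable_kernel (hsol : M.IsDGSolution k T δ γ uh qh) (hab : a < b)
    (hδ : 0 ≤ δ) (hγ : IntervalIntegrable γ volume 0 δ) (ht : t ∈ Icc 0 T)
    (hφ : φ ∈ boundedPeriodic (b - a)) {l r : ℝ} (hal : a ≤ l) (hlr : l ≤ r) (hrb : r ≤ b) :
    IntervalIntegrable (fun s => s ^ 2 * γ s * ∫ x in l..r, diffQuot (-s) (qh t s) x * φ x)
      volume 0 δ := by
  refine intervalIntegrable_sq_mul_kernel_mul hδ hγ
    (C := 4 * l2norm a b (uh t) * l2norm a b φ) ?_ fun s hs => ?_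
  · refine (Finset.aestronglyMeasurable_fun_sum Finset.univ fun m _ =>
      (hsol.aestronglyMeasurable_qh_interpNode hab ht m).mul
        ((aestronglyMeasurable_integral_diffQuot_mul (M.nodalBasis_mem_boundedPeriodic m) hφ l r
          ).comp_measurePreserving (Measure.measurePreserving_neg volume)).restrict).congr
      ((ae_restrict_iff' measurableSet_Ioc).2 (.of_forall fun s hs => ?_))
    exact (M.integral_diffQuot_mul_eq_sum_nodalBasis hab (hsol.mem_qh t ht s hs) hφ (-s) l r).symm
  · have hs0 : 0 < s := hs.1
    calc _ ≤ 2 / |-s| * l2norm a b (qh t s) * l2norm a b φ :=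
          abs_integral_diffQuot_mul_le hal hlr hrb
            (M.dgSpace_le_boundedPeriodic hab k (hsol.mem_qh t ht s hs)) hφ (-s)
      _ ≤ 2 / s * (2 / s * l2norm a b (uh t)) * l2norm a b φ := by
          rw [abs_neg, abs_of_pos hs0]
          gcongr
          · exact lpNorm_nonneg
          · exact hsol.l2norm_qh_le hab ht hs
      _ = _ := by ring

theorem differentiableOn_uh (hsol : M.IsDGSolution k T δ γ uh qh) (j : Fin M.N) {x : ℝ}
    (hx : x ∈ Ioo (M.left j) (M.right j)) : DifferentiableOn ℝ (fun t => uh t x) (Icc 0 T) :=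
  (hsol.contDiff_time j x hx).differentiableOn two_ne_zero

theorem differentiableOn_timeDeriv (hsol : M.IsDGSolution k T δ γ uh qh) (hT : 0 < T)
    (j : Fin M.N) {x : ℝ} (hx : x ∈ Ioo (M.left j) (M.right j)) :
    DifferentiableOn ℝ (fun t => timeDeriv T uh t x) (Icc 0 T) :=
  ((hsol.contDiff_time j x hx).derivWithin (m := 1) (uniqueDiffOn_Icc hT) le_rfl).differentiableOn
    one_ne_zero

theorem timeDeriv_uh_mem (hsol : M.IsDGSolution k T δ γ uh qh) (ht : t ∈ Icc 0 T) :
    timeDeriv T uh t ∈ M.dgSpace k :=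
  M.timeDeriv_mem_dgSpace hsol.mem_uh (fun j _ => hsol.differentiableOn_uh j) ht

theorem timeDeriv_timeDeriv_uh_mem (hsol : M.IsDGSolution k T δ γ uh qh) (hT : 0 < T)
    (ht : t ∈ Icc 0 T) : timeDeriv T (timeDeriv T uh) t ∈ M.dgSpace k :=
  M.timeDeriv_mem_dgSpace (fun _ => hsol.timeDeriv_uh_mem)
    (fun j _ => hsol.differentiableOn_timeDeriv hT j) ht

theorem integral_timeDeriv_mul (hsol : M.IsDGSolution k T δ γ uh qh) (hab : a < b) (hT : 0 < T)
    (hδ : 0 ≤ δ) (hγ : IntervalIntegrable γ volume 0 δ) (ht : t ∈ Icc 0 T)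
    (hφ : φ ∈ M.dgSpace k) :
    ∫ x in a..b, timeDeriv T (timeDeriv T uh) t x * φ x =
      2 * ∫ s in 0..δ, s ^ 2 * γ s * ∫ x in a..b, diffQuot (-s) (qh t s) x * φ x := by
  have hbdd := M.dgSpace_le_boundedPeriodic hab k
  have hcell : ∀ j, ∫ x in (M.left j)..(M.right j), timeDeriv T (timeDeriv T uh) t x * φ x =
      2 * ∫ s in 0..δ, s ^ 2 * γ s *
        ∫ x in (M.left j)..(M.right j), diffQuot (-s) (qh t s) x * φ x := fun j => by
    simpa only [opK, diffQuot_neg_apply] using sub_eq_zero.1 (hsol.wave_eq t ht φ hφ j)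
  rw [← M.sum_integral_cells (intervalIntegrable_mul_of_mem_boundedPeriodic
    (hbdd (hsol.timeDeriv_timeDeriv_uh_mem hT ht)) (hbdd hφ))]
  simp only [hcell, ← Finset.mul_sum]
  rw [← intervalIntegral.integral_finsetSum fun j _ => hsol.intervalIntegrable_kernel hab hδ hγ ht
    (hbdd hφ) (M.le_left j) (M.left_lt_right j).le (M.right_le j)]
  refine congrArg _ (intervalIntegral.integral_congr_ae (.of_forall fun s hs => ?_))
  rw [uIoc_of_le hδ] at hs
  rw [← Finset.mul_sum, M.sum_integral_cells (intervalIntegrable_mul_of_mem_boundedPeriodic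
    (diffQuot_mem_boundedPeriodic (hbdd (hsol.mem_qh t ht s hs)) (-s)) (hbdd hφ))]

end Mesh.IsDGSolution

/-! ### The exact solution -/

theorem sq_mul_diffQuot_neg_diffQuot (s : ℝ) (v : ℝ → ℝ) (x : ℝ) :
    s ^ 2 * diffQuot (-s) (diffQuot s v) x = v (x + s) - 2 * v x + v (x - s) := by
  rw [diffQuot_neg_apply, diffQuot_apply, diffQuot_apply, sub_add_cancel]
  rcases eq_or_ne s 0 with rfl | hs
  · simp only [add_zero, sub_zero]
    ring
  · field_simp
    ring

theorem integrable_kernel_mul_diffQuot_neg_diffQuot {δ L : ℝ} (hL : L ≠ 0) {γ v φ : ℝ → ℝ}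
    (hγ : IntervalIntegrable γ volume 0 δ) (hv : Continuous v) (hper : Function.Periodic v L)
    (hφ : IntervalIntegrable φ volume a b) :
    Integrable (fun p : ℝ × ℝ => p.1 ^ 2 * γ p.1 * (diffQuot (-p.1) (diffQuot p.1 v) p.2 * φ p.2))
      ((volume.restrict (Ioc 0 δ)).prod (volume.restrict (Ioc a b))) := by
  obtain ⟨C, hC⟩ := (hper.isBounded_of_continuous hL hv).exists_norm_le
  have hC' : ∀ x, |v x| ≤ C := fun x => hC _ (mem_range_self x)
  have hprod := (hγ.1.mul_prod hφ.1).bdd_mul (c := 4 * C)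
    (f := fun p : ℝ × ℝ => v (p.2 + p.1) - 2 * v p.2 + v (p.2 - p.1))
    (Continuous.aestronglyMeasurable (by fun_prop)) (.of_forall fun p => ?_)
  · simp only [← sq_mul_diffQuot_neg_diffQuot] at hprod
    exact hprod.congr (.of_forall fun p => by ring)
  · rw [Real.norm_eq_abs, abs_le]
    have h₁ := abs_le.1 (hC' (p.2 + p.1))
    have h₂ := abs_le.1 (hC' p.2)
    have h₃ := abs_le.1 (hC' (p.2 - p.1))
    constructor <;> linarith

theorem continuous_of_continuousOn_prod {S : Set ℝ} {w : ℝ → ℝ → ℝ}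
    (hw : ContinuousOn (fun p : ℝ × ℝ => w p.1 p.2) (S ×ˢ univ)) {t : ℝ} (ht : t ∈ S) :
    Continuous (w t) :=
  hw.comp_continuous (Continuous.prodMk_right t) fun _ => ⟨ht, mem_univ _⟩

namespace IsSmoothSolution

variable {T δ : ℝ} {γ : ℝ → ℝ} {k : ℕ} {u : ℝ → ℝ → ℝ} {q : ℝ → ℝ → ℝ → ℝ} {t : ℝ}

theorem q_eq_diffQuot (hsol : IsSmoothSolution a b T δ γ k u q) (ht : t ∈ Icc 0 T) {s : ℝ}
    (hs : s ∈ Ioc 0 δ) : q t s = diffQuot s (u t) := by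
  ext x
  rw [diffQuot_apply, sub_eq_zero.1 (hsol.grad_eq t ht s hs x)]

theorem continuous_apply (hsol : IsSmoothSolution a b T δ γ k u q) (ht : t ∈ Icc 0 T) :
    Continuous (u t) :=
  (hsol.contDiff_u t ht).continuous

theorem integrable_kernel (hsol : IsSmoothSolution a b T δ γ k u q) (hab : a < b)
    (hγ : IntervalIntegrable γ volume 0 δ) (ht : t ∈ Icc 0 T) {φ : ℝ → ℝ}
    (hφ : IntervalIntegrable φ volume a b) :
    Integrable (fun p : ℝ × ℝ =>
        p.1 ^ 2 * γ p.1 * (diffQuot (-p.1) (diffQuot p.1 (u t)) p.2 * φ p.2))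
      ((volume.restrict (Ioc 0 δ)).prod (volume.restrict (Ioc a b))) :=
  integrable_kernel_mul_diffQuot_neg_diffQuot (sub_ne_zero.2 hab.ne') hγ
    (hsol.continuous_apply ht) (hsol.periodic t ht) hφ

theorem intervalIntegrable_kernel (hsol : IsSmoothSolution a b T δ γ k u q) (hab : a < b)
    (hδ : 0 ≤ δ) (hγ : IntervalIntegrable γ volume 0 δ) (ht : t ∈ Icc 0 T) {φ : ℝ → ℝ}
    (hφ : IntervalIntegrable φ volume a b) :
    IntervalIntegrable
      (fun s => s ^ 2 * γ s * ∫ x in a..b, diffQuot (-s) (diffQuot s (u t)) x * φ x)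
      volume 0 δ := by
  have hint := (hsol.integrable_kernel hab hγ ht hφ).integral_prod_left
  simp only [← intervalIntegral.integral_of_le hab.le,
    intervalIntegral.integral_const_mul] at hint
  exact (intervalIntegrable_iff_integrableOn_Ioc_of_le hδ).2 hint

theorem timeDeriv_timeDeriv_eq (hsol : IsSmoothSolution a b T δ γ k u q) (hδ : 0 ≤ δ)
    (ht : t ∈ Ioo 0 T) {x : ℝ} (hx : x ∈ Ioo a b) :
    timeDeriv T (timeDeriv T u) t x =
      2 * ∫ s in 0..δ, s ^ 2 * γ s * diffQuot (-s) (diffQuot s (u t)) x := by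
  rw [sub_eq_zero.1 (hsol.wave_eq t ht x hx)]
  refine congrArg _ (intervalIntegral.integral_congr_ae (.of_forall fun s hs => ?_))
  rw [uIoc_of_le hδ] at hs
  rw [diffQuot_neg_apply, hsol.q_eq_diffQuot (Ioo_subset_Icc_self ht) hs]

theorem integral_timeDeriv_mul (hsol : IsSmoothSolution a b T δ γ k u q) (hab : a < b)
    (hδ : 0 ≤ δ) (hγ : IntervalIntegrable γ volume 0 δ) (ht : t ∈ Ioo 0 T) {φ : ℝ → ℝ}
    (hφ : IntervalIntegrable φ volume a b) :
    ∫ x in a..b, timeDeriv T (timeDeriv T u) t x * φ x =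
      2 * ∫ s in 0..δ, s ^ 2 * γ s * ∫ x in a..b, diffQuot (-s) (diffQuot s (u t)) x * φ x := by
  have hswap := integral_integral_swap
    (f := fun s x => s ^ 2 * γ s * (diffQuot (-s) (diffQuot s (u t)) x * φ x))
    (hsol.integrable_kernel hab hγ (Ioo_subset_Icc_self ht) hφ)
  simp only [intervalIntegral.integral_const_mul, ← intervalIntegral.integral_of_le hab.le,
    ← intervalIntegral.integral_of_le hδ] at hswap
  rw [hswap, ← intervalIntegral.integral_const_mul]
  simp only [intervalIntegral.integral_of_le hab.le, integral_Ioc_eq_integral_Ioo]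
  refine setIntegral_congr_fun measurableSet_Ioo fun x hx => ?_
  simp only [hsol.timeDeriv_timeDeriv_eq hδ ht hx, ← mul_assoc,
    intervalIntegral.integral_mul_const]

end IsSmoothSolution

/-! ### The error estimate -/

section Error

variable {M : Mesh a b} {k : ℕ} {T δ : ℝ} {γ : ℝ → ℝ} {u uh : ℝ → ℝ → ℝ} {q qh : ℝ → ℝ → ℝ → ℝ}
  {t : ℝ} {φ : ℝ → ℝ}

theorem abs_integral_diffQuot_error_mul_le (hab : a < b) (hu : IsSmoothSolution a b T δ γ k u q)
    (huh : M.IsDGSolution k T δ γ uh qh) (ht : t ∈ Icc 0 T) (hφ : φ ∈ boundedPeriodic (b - a))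
    {s : ℝ} (hs : s ∈ Ioc 0 δ) :
    |(∫ x in a..b, diffQuot (-s) (qh t s) x * φ x) -
        ∫ x in a..b, diffQuot (-s) (diffQuot s (u t)) x * φ x| ≤
      4 * (l2norm a b (uh t - u t) + 2 * (M.size ^ (k + 1) *
        sobolevSeminorm a b (k + 1) (u t))) * l2norm a b φ / s ^ 2 := by
  have hq := M.dgSpace_le_boundedPeriodic hab k (huh.mem_qh t ht s hs)
  have hDu := diffQuot_mem_boundedPeriodic (mem_boundedPeriodic_of_continuous
    (sub_ne_zero.2 hab.ne') (hu.continuous_apply ht) (hu.periodic t ht)) s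
  have hs0 : 0 < s := hs.1
  rw [← integral_sub_mul_of_mem_boundedPeriodic (diffQuot_mem_boundedPeriodic hq _)
    (diffQuot_mem_boundedPeriodic hDu _) hφ, ← map_sub]
  calc |∫ x in a..b, diffQuot (-s) (qh t s - diffQuot s (u t)) x * φ x|
    _ ≤ 2 / |-s| * l2norm a b (qh t s - diffQuot s (u t)) * l2norm a b φ :=
        abs_integral_diffQuot_mul_le le_rfl hab.le le_rfl (Submodule.sub_mem _ hq hDu) hφ _
    _ ≤ 2 / s * (2 / s * (l2norm a b (uh t - u t) + 2 * (M.size ^ (k + 1) *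
          sobolevSeminorm a b (k + 1) (u t)))) * l2norm a b φ := by
        rw [abs_neg, abs_of_pos hs0]
        gcongr
        · exact lpNorm_nonneg
        · exact huh.l2norm_qh_sub_diffQuot_le hab ht hs (hu.contDiff_u t ht) (hu.periodic t ht)
    _ = _ := by ring

theorem abs_integral_error_timeDeriv_mul_le (hab : a < b) (hT : 0 < T) (hδ : 0 ≤ δ)
    (hγ : IntervalIntegrable γ volume 0 δ) (hu : IsSmoothSolution a b T δ γ k u q)
    (huh : M.IsDGSolution k T δ γ uh qh) (ht : t ∈ Ioo 0 T) (hφ : φ ∈ M.dgSpace k) :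
    |(∫ x in a..b, timeDeriv T (timeDeriv T uh) t x * φ x) -
        ∫ x in a..b, timeDeriv T (timeDeriv T u) t x * φ x| ≤
      8 * (∫ s in 0..δ, |γ s|) * (l2norm a b (uh t - u t) +
        2 * (M.size ^ (k + 1) * sobolevSeminorm a b (k + 1) (u t))) * l2norm a b φ := by
  have ht' := Ioo_subset_Icc_self ht
  have hφb := M.dgSpace_le_boundedPeriodic hab k hφ
  have hφi := intervalIntegrable_of_mem_boundedPeriodic hφb a b
  rw [huh.integral_timeDeriv_mul hab hT hδ hγ ht' hφ, hu.integral_timeDeriv_mul hab hδ hγ ht hφi,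
    ← mul_sub, ← intervalIntegral.integral_sub
      (huh.intervalIntegrable_kernel hab hδ hγ ht' hφb le_rfl hab.le le_rfl)
      (hu.intervalIntegrable_kernel hab hδ hγ ht' hφi), abs_mul, abs_two]
  simp only [← mul_sub]
  linarith [abs_integral_sq_mul_kernel_mul_le hδ hγ fun s hs =>
    abs_integral_diffQuot_error_mul_le hab hu huh ht' hφb hs]

end Error

theorem abs_le_of_abs_hasDerivAt_le {l r : ℝ} {f f' B B' : ℝ → ℝ} (hf : ContinuousOn f (Icc l r))
    (hf' : ∀ t ∈ Ioo l r, HasDerivAt f (f' t) t) (hB : ContinuousOn B (Icc l r))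
    (hB' : ∀ t ∈ Ioo l r, HasDerivAt B (B' t) t) (hinit : |f l| ≤ B l)
    (hbound : ∀ t ∈ Ioo l r, |f' t| ≤ B' t) {t : ℝ} (ht : t ∈ Icc l r) : |f t| ≤ B t := by
  have hl : l ∈ Icc l r := left_mem_Icc.2 (ht.1.trans ht.2)
  obtain ⟨hinit₁, hinit₂⟩ := abs_le.1 hinit
  rw [← interior_Icc] at hf' hB' hbound
  have hsub := monotoneOn_of_hasDerivWithinAt_nonneg (convex_Icc l r) (hB.sub hf)
    (fun τ hτ => ((hB' τ hτ).sub (hf' τ hτ)).hasDerivWithinAt)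
    (fun τ hτ => by linarith [(abs_le.1 (hbound τ hτ)).2]) hl ht ht.1
  have hadd := monotoneOn_of_hasDerivWithinAt_nonneg (convex_Icc l r) (hB.add hf)
    (fun τ hτ => ((hB' τ hτ).add (hf' τ hτ)).hasDerivWithinAt)
    (fun τ hτ => by linarith [(abs_le.1 (hbound τ hτ)).1]) hl ht ht.1
  simp only [Pi.sub_apply, Pi.add_apply] at hsub hadd
  exact abs_le.2 ⟨by linarith, by linarith⟩

theorem abs_le_of_abs_second_deriv_le_exp {T α β lam : ℝ} {f f' f'' : ℝ → ℝ} (hα : 0 ≤ α)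
    (hlam : 0 < lam) (hf : ContinuousOn f (Icc 0 T)) (hf' : ContinuousOn f' (Icc 0 T))
    (hderiv : ∀ t ∈ Ioo 0 T, HasDerivAt f (f' t) t)
    (hderiv' : ∀ t ∈ Ioo 0 T, HasDerivAt f' (f'' t) t) (h0 : f 0 = 0) (h0' : f' 0 = 0)
    (hbound : ∀ t ∈ Ioo 0 T, |f'' t| ≤ α * Real.exp (lam * t) + β) {t : ℝ} (ht : t ∈ Icc 0 T) :
    |f t| ≤ α / lam ^ 2 * Real.exp (lam * t) + β / 2 * t ^ 2 := by
  have hexp : ∀ c τ, HasDerivAt (fun τ => c / lam * Real.exp (lam * τ))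
      (c * Real.exp (lam * τ)) τ := fun c τ =>
    ((hasDerivAt_const_mul lam).exp.const_mul (c / lam)).congr_deriv (by field_simp)
  have hfirst : ∀ τ ∈ Icc 0 T, |f' τ| ≤ α / lam * Real.exp (lam * τ) + β * τ := fun τ hτ =>
    abs_le_of_abs_hasDerivAt_le (B := fun τ => α / lam * Real.exp (lam * τ) + β * τ)
      hf' hderiv' (by fun_prop) (fun τ _ => (hexp α τ).fun_add (hasDerivAt_const_mul β))
      (by simp only [h0', abs_zero, mul_zero, add_zero]; positivity) hbound hτ
  refine abs_le_of_abs_hasDerivAt_le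
    (B := fun τ => α / lam ^ 2 * Real.exp (lam * τ) + β / 2 * τ ^ 2) hf hderiv (by fun_prop)
    (fun τ _ => ?_) ?_ (fun τ hτ => hfirst τ (Ioo_subset_Icc_self hτ)) ht
  · rw [pow_two lam, ← div_div]
    refine (hexp (α / lam) τ).fun_add (((hasDerivAt_pow 2 τ).const_mul (β / 2)).congr_deriv ?_)
    ring
  · simp only [h0, abs_zero, mul_zero, zero_pow two_ne_zero, add_zero]
    positivity

theorem le_of_forall_exp_bound_improves {T K lam : ℝ} {m : ℝ → ℝ} (hlam : 0 ≤ lam)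
    (hm0 : ∀ t ∈ Icc 0 T, 0 ≤ m t) (hm : BddAbove (m '' Icc 0 T))
    (himp : ∀ R, 0 ≤ R → (∀ t ∈ Icc 0 T, m t ≤ R * Real.exp (lam * t)) →
      ∀ t ∈ Icc 0 T, m t ≤ (R / 2 + K) * Real.exp (lam * t)) {t : ℝ} (ht : t ∈ Icc 0 T) :
    m t ≤ 2 * K * Real.exp (lam * t) := by
  let S : Set ℝ := (fun t => m t / Real.exp (lam * t)) '' Icc 0 T
  have hdiv : ∀ t R, m t ≤ R * Real.exp (lam * t) ↔ m t / Real.exp (lam * t) ≤ R :=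
    fun t R => (div_le_iff₀ (Real.exp_pos _)).symm
  have hbdd : BddAbove S := by
    obtain ⟨B, hB⟩ := hm
    refine ⟨B, forall_mem_image.2 fun τ hτ => ?_⟩
    exact (div_le_self (hm0 τ hτ) (Real.one_le_exp (mul_nonneg hlam hτ.1))).trans
      (hB (mem_image_of_mem m hτ))
  have hle : ∀ τ ∈ Icc 0 T, m τ / Real.exp (lam * τ) ≤ sSup S := fun τ hτ =>
    le_csSup hbdd (mem_image_of_mem _ hτ)
  have hS0 : 0 ≤ sSup S := (div_nonneg (hm0 t ht) (Real.exp_pos _).le).trans (hle t ht)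
  have hS : sSup S ≤ sSup S / 2 + K :=
    csSup_le ⟨_, mem_image_of_mem _ ht⟩ (forall_mem_image.2 fun τ hτ =>
      (hdiv τ _).1 (himp _ hS0 (fun τ hτ => (hdiv τ _).2 (hle τ hτ)) τ hτ))
  rw [hdiv]
  linarith [hle t ht]

section TimeIntegral

variable {T : ℝ} {w : ℝ → ℝ → ℝ} {φ : ℝ → ℝ}

theorem exists_abs_le_of_continuousOn_prod {S : Set ℝ} (hS : IsCompact S)
    (hw : ContinuousOn (fun p : ℝ × ℝ => w p.1 p.2) (S ×ˢ univ)) (a b : ℝ) :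
    ∃ B, ∀ t ∈ S, ∀ x ∈ uIoc a b, |w t x| ≤ B := by
  obtain ⟨B, hB⟩ := (hS.prod isCompact_uIcc).exists_bound_of_continuousOn
    (hw.mono (prod_mono_right (subset_univ (uIcc a b))))
  exact ⟨B, fun t ht x hx => hB (t, x) ⟨ht, uIoc_subset_uIcc hx⟩⟩

theorem continuousOn_integral_mul {S : Set ℝ} (hS : IsCompact S)
    (hw : ContinuousOn (fun p : ℝ × ℝ => w p.1 p.2) (S ×ˢ univ))
    (hφ : IntervalIntegrable φ volume a b) :
    ContinuousOn (fun t => ∫ x in a..b, w t x * φ x) S := by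
  obtain ⟨B, hB⟩ := exists_abs_le_of_continuousOn_prod hS hw a b
  refine fun t ht => intervalIntegral.continuousWithinAt_of_dominated_interval
    (bound := fun x => B * |φ x|) ?_ ?_ (hφ.abs.const_mul B) ?_
  · filter_upwards [self_mem_nhdsWithin] with r hr
    exact (continuous_of_continuousOn_prod hw hr).aestronglyMeasurable.mul
      hφ.def'.aestronglyMeasurable
  · filter_upwards [self_mem_nhdsWithin] with r hr
    refine .of_forall fun x hx => ?_
    rw [norm_mul]
    exact mul_le_mul_of_nonneg_right (hB r hr x hx) (norm_nonneg _)
  · refine .of_forall fun x _ => ContinuousWithinAt.mul ?_ continuousWithinAt_const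
    exact (hw.comp (Continuous.prodMk_left x).continuousOn fun r hr => ⟨hr, mem_univ x⟩) t ht

theorem hasDerivAt_timeDeriv {x : ℝ} (hdiff : DifferentiableOn ℝ (fun t => w t x) (Icc 0 T))
    {t : ℝ} (ht : t ∈ Ioo 0 T) : HasDerivAt (fun r => w r x) (timeDeriv T w t x) t :=
  (hdiff t (Ioo_subset_Icc_self ht)).hasDerivWithinAt.hasDerivAt (Icc_mem_nhds ht.1 ht.2)

theorem hasDerivAt_integral_mul (hdiff : ∀ x, DifferentiableOn ℝ (fun t => w t x) (Icc 0 T))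
    (hw : ContinuousOn (fun p : ℝ × ℝ => w p.1 p.2) (Icc 0 T ×ˢ univ))
    (hw' : ContinuousOn (fun p : ℝ × ℝ => timeDeriv T w p.1 p.2) (Icc 0 T ×ˢ univ))
    (hφ : IntervalIntegrable φ volume a b) {t : ℝ} (ht : t ∈ Ioo 0 T) :
    HasDerivAt (fun r => ∫ x in a..b, w r x * φ x) (∫ x in a..b, timeDeriv T w t x * φ x) t := by
  obtain ⟨B, hB⟩ := exists_abs_le_of_continuousOn_prod isCompact_Icc hw' a b
  have hmem : ∀ᶠ r in nhds t, r ∈ Icc 0 T := Icc_mem_nhds ht.1 ht.2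
  have ht' := Ioo_subset_Icc_self ht
  refine (intervalIntegral.hasDerivAt_integral_of_dominated_loc_of_deriv_le
    (F := fun r x => w r x * φ x) (F' := fun r x => timeDeriv T w r x * φ x)
    (bound := fun x => B * |φ x|) (Ioo_mem_nhds ht.1 ht.2) ?_
    (hφ.continuousOn_mul (continuous_of_continuousOn_prod hw ht').continuousOn) ?_ ?_
    (hφ.abs.const_mul B) ?_).2
  · filter_upwards [hmem] with r hr
    exact (continuous_of_continuousOn_prod hw hr).aestronglyMeasurable.mul
      hφ.def'.aestronglyMeasurable
  · exact (continuous_of_continuousOn_prod hw' ht').aestronglyMeasurable.mul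
      hφ.def'.aestronglyMeasurable
  · refine .of_forall fun x hx r hr => ?_
    rw [norm_mul]
    exact mul_le_mul_of_nonneg_right (hB r (Ioo_subset_Icc_self hr) x hx) (norm_nonneg _)
  · exact .of_forall fun x _ r hr => (hasDerivAt_timeDeriv (hdiff x) hr).mul_const _

end TimeIntegral

namespace Mesh

variable {k : ℕ}

theorem IsL2Projection.integral_mul_eq {M : Mesh a b} {f g φ : ℝ → ℝ}
    (hproj : M.IsL2Projection k f g) (hab : a < b) (hf : f ∈ boundedPeriodic (b - a))
    (hφ : φ ∈ M.dgSpace k) : ∫ x in a..b, g x * φ x = ∫ x in a..b, f x * φ x := by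
  have hφb := M.dgSpace_le_boundedPeriodic hab k hφ
  have hgb := M.dgSpace_le_boundedPeriodic hab k hproj.1
  rw [eq_comm, ← sub_eq_zero, ← integral_sub_mul_of_mem_boundedPeriodic hf hgb hφb,
    ← M.sum_integral_cells (intervalIntegrable_mul_of_mem_boundedPeriodic
      (Submodule.sub_mem _ hf hgb) hφb)]
  refine Finset.sum_eq_zero fun j _ => ?_
  obtain ⟨p, hp, hφp⟩ := hφ.2 j
  rw [← hproj.2 j p hp]
  exact M.integral_cell_congr j fun x hx => by rw [hφp x hx, Pi.sub_apply]

theorem l2norm_sub_le_of_abs_integral_mul_le (M : Mesh a b) (hab : a < b) {c : ℝ} {v f : ℝ → ℝ}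
    (hc0 : 0 ≤ c) (hv : v ∈ M.dgSpace k) (hf : ContDiff ℝ (k + 1 : ℕ) f)
    (hper : Function.Periodic f (b - a))
    (hc : ∀ φ ∈ M.dgSpace k,
      |(∫ x in a..b, v x * φ x) - ∫ x in a..b, f x * φ x| ≤ c * l2norm a b φ) :
    l2norm a b (v - f) ≤ c + 2 * (M.size ^ (k + 1) * sobolevSeminorm a b (k + 1) f) := by
  have hfb := mem_boundedPeriodic_of_continuous (sub_ne_zero.2 hab.ne') hf.continuous hper
  obtain ⟨w, hw, happrox⟩ := M.exists_mem_dgSpace_l2norm_sub_le hab hf hper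
  have hvb := M.dgSpace_le_boundedPeriodic hab k hv
  have hwb := M.dgSpace_le_boundedPeriodic hab k hw
  have hφ : v - w ∈ M.dgSpace k := Submodule.sub_mem _ hv hw
  have hφb := M.dgSpace_le_boundedPeriodic hab k hφ
  have hL2 := fun {g} (hg : g ∈ boundedPeriodic (b - a)) => memLp_two_of_mem_boundedPeriodic hg a b
  have hsq : l2norm a b (v - w) ^ 2 = ((∫ x in a..b, v x * (v - w) x) -
      ∫ x in a..b, f x * (v - w) x) + ∫ x in a..b, (f - w) x * (v - w) x := by
    rw [sq_l2norm hab.le (hL2 hφb).1, integral_sub_mul_of_mem_boundedPeriodic hfb hwb hφb,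
      sub_add_sub_cancel, ← integral_sub_mul_of_mem_boundedPeriodic hvb hwb hφb]
    simp only [pow_two]
  have hdiscrete : l2norm a b (v - w) ≤ c + l2norm a b (f - w) := by
    have hcs := (le_abs_self _).trans (abs_integral_mul_le_l2norm_mul le_rfl hab.le le_rfl
      (Submodule.sub_mem _ hfb hwb) hφb)
    rcases (lpNorm_nonneg : 0 ≤ l2norm a b (v - w)).eq_or_lt with h0 | hpos
    · exact h0.symm.trans_le (add_nonneg hc0 lpNorm_nonneg)
    · refine le_of_mul_le_mul_right ?_ hpos
      linarith [(le_abs_self _).trans (hc _ hφ)]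
  calc l2norm a b (v - f) ≤ l2norm a b (v - w) + l2norm a b (w - f) :=
        lpNorm_sub_le_lpNorm_sub_add_lpNorm_sub (hL2 hvb) (hL2 hwb) one_le_two
    _ ≤ _ := by
        rw [l2norm, l2norm, lpNorm_sub_comm w f]
        linarith

end Mesh

theorem continuousOn_l2norm_of_continuousOn_prod (hab : a ≤ b) {S : Set ℝ} (hS : IsCompact S)
    {w : ℝ → ℝ → ℝ} (hw : ContinuousOn (fun p : ℝ × ℝ => w p.1 p.2) (S ×ˢ univ)) :
    ContinuousOn (fun t => l2norm a b (w t)) S := by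
  have hsq : ContinuousOn (fun t => √(∫ x in a..b, w t x ^ 2 * 1)) S :=
    (continuousOn_integral_mul hS (hw.pow 2) intervalIntegrable_const).sqrt
  refine hsq.congr fun t ht => ?_
  simp only [mul_one]
  rw [← sq_l2norm hab (continuous_of_continuousOn_prod hw ht).aestronglyMeasurable,
    Real.sqrt_sq lpNorm_nonneg]

theorem Mesh.continuousOn_l2norm (M : Mesh a b) (hab : a < b) {k : ℕ} {S : Set ℝ}
    {w : ℝ → ℝ → ℝ} (hw : ∀ t ∈ S, w t ∈ M.dgSpace k)
    (hcont : ∀ m : Fin M.N × Fin (k + 1), ContinuousOn (fun t => w t (M.interpNode m)) S) :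
    ContinuousOn (fun t => l2norm a b (w t)) S := by
  have hsq : ContinuousOn (fun t => √(∑ m : Fin M.N × Fin (k + 1), w t (M.interpNode m) *
      ∑ n : Fin M.N × Fin (k + 1), w t (M.interpNode n) *
        ∫ x in a..b, M.nodalBasis n x * M.nodalBasis m x)) S :=
    (continuousOn_finsetSum _ fun m _ => (hcont m).mul <|
      continuousOn_finsetSum _ fun n _ => (hcont n).mul continuousOn_const).sqrt
  refine hsq.congr fun t ht => ?_
  have hwt := M.dgSpace_le_boundedPeriodic hab k (hw t ht)
  simp only [← M.integral_mul_eq_sum_nodalBasis hab (hw t ht)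
    (M.nodalBasis_mem_boundedPeriodic _) a b, mul_comm (w t _) (M.nodalBasis _ _)]
  rw [← M.integral_mul_eq_sum_nodalBasis hab (hw t ht) hwt a b]
  simp only [← pow_two]
  rw [← sq_l2norm hab.le (memLp_two_of_mem_boundedPeriodic hwt a b).1,
    Real.sqrt_sq lpNorm_nonneg]

section Error

variable {M : Mesh a b} {k : ℕ} {T δ : ℝ} {γ : ℝ → ℝ} {u uh : ℝ → ℝ → ℝ} {q qh : ℝ → ℝ → ℝ → ℝ}

theorem bddAbove_l2norm_error (hab : a < b) (hu : IsSmoothSolution a b T δ γ k u q)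
    (huh : M.IsDGSolution k T δ γ uh qh) :
    BddAbove ((fun t => l2norm a b (uh t - u t)) '' Icc 0 T) := by
  obtain ⟨B, hB⟩ := isCompact_Icc.bddAbove_image
    ((M.continuousOn_l2norm hab huh.mem_uh fun m =>
      (huh.differentiableOn_uh m.1 (M.interpNode_mem m)).continuousOn).add
    (continuousOn_l2norm_of_continuousOn_prod hab.le isCompact_Icc hu.continuous_u))
  refine ⟨B, forall_mem_image.2 fun t ht => (lpNorm_sub_le ?_ one_le_two).trans
    (hB (mem_image_of_mem _ ht))⟩
  exact memLp_two_of_mem_boundedPeriodic (M.dgSpace_le_boundedPeriodic hab k (huh.mem_uh t ht)) a b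

theorem abs_integral_error_mul_le {α β lam : ℝ} {φ : ℝ → ℝ} (hab : a < b) (hT : 0 < T)
    (hu : IsSmoothSolution a b T δ γ k u q) (huh : M.IsDGSolution k T δ γ uh qh)
    (hproj : M.IsL2Projection k (u 0) (uh 0))
    (hproj' : M.IsL2Projection k (timeDeriv T u 0) (timeDeriv T uh 0)) (hφ : φ ∈ M.dgSpace k)
    (hα : 0 ≤ α) (hlam : 0 < lam)
    (hbound : ∀ t ∈ Ioo 0 T, |(∫ x in a..b, timeDeriv T (timeDeriv T uh) t x * φ x) -
      ∫ x in a..b, timeDeriv T (timeDeriv T u) t x * φ x| ≤ α * Real.exp (lam * t) + β)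
    {t : ℝ} (ht : t ∈ Icc 0 T) :
    |(∫ x in a..b, uh t x * φ x) - ∫ x in a..b, u t x * φ x| ≤
      α / lam ^ 2 * Real.exp (lam * t) + β / 2 * t ^ 2 := by
  have hφb := M.dgSpace_le_boundedPeriodic hab k hφ
  have hφi := intervalIntegrable_of_mem_boundedPeriodic hφb a b
  have h0 : (0 : ℝ) ∈ Icc 0 T := ⟨le_rfl, hT.le⟩
  have hL := sub_ne_zero.2 hab.ne'
  have hudiff : ∀ x, ContDiffOn ℝ 1 (fun t => timeDeriv T u t x) (Icc 0 T) := fun x =>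
    (hu.contDiff_time x).derivWithin (uniqueDiffOn_Icc hT) le_rfl
  have huh' := fun {t} (ht : t ∈ Icc 0 T) =>
    M.hasDerivWithinAt_integral_mul hab huh.mem_uh (fun j _ => huh.differentiableOn_uh j) hφb ht
  have huh'' := fun {t} (ht : t ∈ Icc 0 T) =>
    M.hasDerivWithinAt_integral_mul hab (fun _ => huh.timeDeriv_uh_mem)
      (fun j _ => huh.differentiableOn_timeDeriv hT j) hφb ht
  refine abs_le_of_abs_second_deriv_le_exp hα hlam
    (f := fun t => (∫ x in a..b, uh t x * φ x) - ∫ x in a..b, u t x * φ x)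
    (f' := fun t => (∫ x in a..b, timeDeriv T uh t x * φ x) - ∫ x in a..b, timeDeriv T u t x * φ x)
    (ContinuousOn.sub (fun t ht => (huh' ht).continuousWithinAt)
      (continuousOn_integral_mul isCompact_Icc hu.continuous_u hφi))
    (ContinuousOn.sub (fun t ht => (huh'' ht).continuousWithinAt)
      (continuousOn_integral_mul isCompact_Icc hu.continuous_ut hφi))
    (fun t ht => ?_) (fun t ht => ?_) ?_ ?_ hbound ht
  · exact ((huh' (Ioo_subset_Icc_self ht)).hasDerivAt (Icc_mem_nhds ht.1 ht.2)).fun_sub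
      (hasDerivAt_integral_mul (fun x => (hu.contDiff_time x).differentiableOn two_ne_zero)
        hu.continuous_u hu.continuous_ut hφi ht)
  · exact ((huh'' (Ioo_subset_Icc_self ht)).hasDerivAt (Icc_mem_nhds ht.1 ht.2)).fun_sub
      (hasDerivAt_integral_mul (fun x => (hudiff x).differentiableOn one_ne_zero)
        hu.continuous_ut hu.continuous_utt hφi ht)
  · exact sub_eq_zero.2 (hproj.integral_mul_eq hab (mem_boundedPeriodic_of_continuous hL
      (hu.continuous_apply h0) (hu.periodic 0 h0)) hφ)
  · exact sub_eq_zero.2 (hproj'.integral_mul_eq hab (mem_boundedPeriodic_of_continuous hL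
      (hu.contDiff_ut 0 h0).continuous (periodic_timeDeriv hu.periodic h0)) hφ)

theorem l2norm_error_le_of_exp_bound {R ε lam : ℝ} (hab : a < b) (hT : 0 < T) (hδ : 0 ≤ δ)
    (hγ : IntervalIntegrable γ volume 0 δ) (hu : IsSmoothSolution a b T δ γ k u q)
    (huh : M.IsDGSolution k T δ γ uh qh) (hproj : M.IsL2Projection k (u 0) (uh 0))
    (hproj' : M.IsL2Projection k (timeDeriv T u 0) (timeDeriv T uh 0))
    (hε : ∀ t ∈ Icc 0 T, M.size ^ (k + 1) * sobolevSeminorm a b (k + 1) (u t) ≤ ε)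
    (hε0 : 0 ≤ ε) (hlam : 0 < lam) (hγlam : 16 * ∫ s in 0..δ, |γ s| ≤ lam ^ 2) (hR : 0 ≤ R)
    (hbound : ∀ t ∈ Icc 0 T, l2norm a b (uh t - u t) ≤ R * Real.exp (lam * t))
    {t : ℝ} (ht : t ∈ Icc 0 T) :
    l2norm a b (uh t - u t) ≤
      (R / 2 + (8 * (∫ s in 0..δ, |γ s|) * T ^ 2 + 2) * ε) * Real.exp (lam * t) := by
  set Γ := ∫ s in 0..δ, |γ s|
  have hΓ : 0 ≤ Γ := intervalIntegral.integral_nonneg hδ fun s _ => abs_nonneg _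
  have hexp : 1 ≤ Real.exp (lam * t) := Real.one_le_exp (mul_nonneg hlam.le ht.1)
  have hweak : ∀ φ ∈ M.dgSpace k, |(∫ x in a..b, uh t x * φ x) - ∫ x in a..b, u t x * φ x| ≤
      (R / 2 * Real.exp (lam * t) + 8 * Γ * ε * T ^ 2) * l2norm a b φ := fun φ hφ => by
    have hφ0 : 0 ≤ l2norm a b φ := lpNorm_nonneg
    calc _ ≤ 8 * Γ * R * l2norm a b φ / lam ^ 2 * Real.exp (lam * t) +
          16 * Γ * ε * l2norm a b φ / 2 * t ^ 2 := by
          refine abs_integral_error_mul_le hab hT hu huh hproj hproj' hφ (by positivity) hlam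
            (fun τ hτ => ?_) ht
          have hτ' := Ioo_subset_Icc_self hτ
          calc _ ≤ _ := abs_integral_error_timeDeriv_mul_le hab hT hδ hγ hu huh hτ hφ
            _ ≤ 8 * Γ * (R * Real.exp (lam * τ) + 2 * ε) * l2norm a b φ := by
                gcongr
                exacts [hbound τ hτ', hε τ hτ']
            _ = _ := by ring
      _ = (R / 2 * (16 * Γ / lam ^ 2) * Real.exp (lam * t) + 8 * Γ * ε * t ^ 2) *
          l2norm a b φ := by ring
      _ ≤ (R / 2 * 1 * Real.exp (lam * t) + 8 * Γ * ε * T ^ 2) * l2norm a b φ := by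
          gcongr
          exacts [div_le_one_of_le₀ hγlam (sq_nonneg _), ht.1, ht.2]
      _ = _ := by rw [mul_one]
  calc l2norm a b (uh t - u t)
    _ ≤ R / 2 * Real.exp (lam * t) + 8 * Γ * ε * T ^ 2 + 2 * ε :=
        (M.l2norm_sub_le_of_abs_integral_mul_le hab (by positivity) (huh.mem_uh t ht)
          (hu.contDiff_u t ht) (hu.periodic t ht) hweak).trans (by linarith [hε t ht])
    _ = R / 2 * Real.exp (lam * t) + (8 * Γ * T ^ 2 + 2) * ε * 1 := by ring
    _ ≤ R / 2 * Real.exp (lam * t) + (8 * Γ * T ^ 2 + 2) * ε * Real.exp (lam * t) := by gcongr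
    _ = _ := by ring

theorem l2norm_error_le {ε lam : ℝ} (hab : a < b) (hT : 0 < T) (hδ : 0 ≤ δ)
    (hγ : IntervalIntegrable γ volume 0 δ) (hu : IsSmoothSolution a b T δ γ k u q)
    (huh : M.IsDGSolution k T δ γ uh qh) (hproj : M.IsL2Projection k (u 0) (uh 0))
    (hproj' : M.IsL2Projection k (timeDeriv T u 0) (timeDeriv T uh 0))
    (hε : ∀ t ∈ Icc 0 T, M.size ^ (k + 1) * sobolevSeminorm a b (k + 1) (u t) ≤ ε)
    (hlam : 0 < lam) (hγlam : 16 * ∫ s in 0..δ, |γ s| ≤ lam ^ 2) {t : ℝ} (ht : t ∈ Icc 0 T) :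
    l2norm a b (uh t - u t) ≤
      2 * ((8 * (∫ s in 0..δ, |γ s|) * T ^ 2 + 2) * ε) * Real.exp (lam * T) := by
  have hε0 : 0 ≤ ε := (mul_nonneg (pow_nonneg M.size_nonneg _) (Real.sqrt_nonneg _)).trans (hε t ht)
  have hΓ : 0 ≤ ∫ s in 0..δ, |γ s| := intervalIntegral.integral_nonneg hδ fun s _ => abs_nonneg _
  refine (le_of_forall_exp_bound_improves hlam.le (fun _ _ => lpNorm_nonneg)
    (bddAbove_l2norm_error hab hu huh) (fun R hR hbound τ hτ => l2norm_error_le_of_exp_bound hab hT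
      hδ hγ hu huh hproj hproj' hε hε0 hlam hγlam hR hbound hτ) ht).trans ?_
  gcongr
  exact ht.2

end Error

end

end NonlocalWave

open NonlocalWave in
theorem theorem3p2_general (a b T δ : ℝ) (hab : a < b) (hT : 0 < T) (hδ : 0 ≤ δ) (k : ℕ)
    (γ : ℝ → ℝ) (hγ : IntervalIntegrable γ volume 0 δ) (A : ℝ) :
    ∃ C : ℝ, 0 < C ∧
      ∀ (u : ℝ → ℝ → ℝ) (q : ℝ → ℝ → ℝ → ℝ), IsSmoothSolution a b T δ γ k u q →
        (∀ t ∈ Icc 0 T, sobolevSeminorm a b (k + 1) (u t) ≤ A) →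
        ∀ (M : Mesh a b) (uh : ℝ → ℝ → ℝ) (qh : ℝ → ℝ → ℝ → ℝ),
          M.IsDGSolution k T δ γ uh qh →
          M.IsL2Projection k (u 0) (uh 0) →
          M.IsL2Projection k (timeDeriv T u 0) (timeDeriv T uh 0) →
          ∀ t ∈ Icc 0 T, (∫ x in a..b, (uh t x - u t x) ^ 2) ≤ C * M.size ^ (2 * k + 2) := by
  set Γ := ∫ s in 0..δ, |γ s|
  have hΓ : 0 ≤ Γ := intervalIntegral.integral_nonneg hδ fun s _ => abs_nonneg _
  set lam := √(16 * Γ + 1)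
  have hγlam : 16 * Γ ≤ lam ^ 2 := by
    rw [Real.sq_sqrt (by positivity)]
    linarith
  let D := 2 * ((8 * Γ * T ^ 2 + 2) * A) * Real.exp (lam * T)
  refine ⟨D ^ 2 + 1, by positivity, fun u q hu hA M uh qh huh hproj hproj' t ht => ?_⟩
  have herr : MemLp (uh t - u t) 2 (volume.restrict (Ioc a b)) :=
    memLp_two_of_mem_boundedPeriodic (Submodule.sub_mem _
      (M.dgSpace_le_boundedPeriodic hab k (huh.mem_uh t ht))
      (mem_boundedPeriodic_of_continuous (sub_ne_zero.2 hab.ne') (hu.continuous_apply ht)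
        (hu.periodic t ht))) a b
  have hle : l2norm a b (uh t - u t) ≤ D * M.size ^ (k + 1) :=
    (l2norm_error_le hab hT hδ hγ hu huh hproj hproj' (fun τ hτ => mul_le_mul_of_nonneg_left
      (hA τ hτ) (pow_nonneg M.size_nonneg _)) (Real.sqrt_pos.2 (by positivity)) hγlam ht).trans_eq
      (by ring)
  calc ∫ x in a..b, (uh t x - u t x) ^ 2 = l2norm a b (uh t - u t) ^ 2 :=
        (sq_l2norm hab.le herr.1).symm
    _ ≤ (D * M.size ^ (k + 1)) ^ 2 := pow_le_pow_left₀ lpNorm_nonneg hle 2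
    _ = D ^ 2 * M.size ^ (2 * k + 2) := by ring
    _ ≤ (D ^ 2 + 1) * M.size ^ (2 * k + 2) :=
        mul_le_mul_of_nonneg_right (by linarith) (pow_nonneg M.size_nonneg _)

theorem theorem3p2 (a b T δ ν : ℝ) (hab : a < b) (hT : 0 < T) (hδ : 0 < δ) (hν : 0 < ν) (k : ℕ)
    (γ : ℝ → ℝ) (hγ : NonlocalWave.IsKernel δ γ) (hγ_loc : LocallyIntegrable γ volume) (A : ℝ) :
    ∃ C : ℝ, 0 < C ∧
      ∀ (u : ℝ → ℝ → ℝ) (q : ℝ → ℝ → ℝ → ℝ),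
        NonlocalWave.IsSmoothSolution a b T δ γ k u q →
        (∀ t ∈ Icc 0 T, NonlocalWave.sobolevSeminorm a b (k + 1) (u t) ≤ A) →
        (∀ t ∈ Icc 0 T,
          NonlocalWave.sobolevSeminorm a b (k + 1) (NonlocalWave.timeDeriv T u t) ≤ A) →
        (∀ t ∈ Icc 0 T, ∀ s ∈ Ioc 0 δ, NonlocalWave.sobolevSeminorm a b (k + 1) (q t s) ≤ A) →
        ∀ M : NonlocalWave.Mesh a b, M.IsRegular ν →
        ∀ (uh : ℝ → ℝ → ℝ) (qh : ℝ → ℝ → ℝ → ℝ),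
          M.IsDGSolution k T δ γ uh qh →
          M.IsL2Projection k (u 0) (uh 0) →
          M.IsL2Projection k (NonlocalWave.timeDeriv T u 0) (NonlocalWave.timeDeriv T uh 0) →
          ∀ t ∈ Icc 0 T, (∫ x in a..b, (uh t x - u t x) ^ 2) ≤ C * M.size ^ (2 * k + 2) := by
  obtain ⟨C, hC, h⟩ := theorem3p2_general a b T δ hab hT hδ.le k γ
    (hγ_loc.integrableOn_isCompact isCompact_uIcc).intervalIntegrable A
  exact ⟨C, hC, fun u q hu hA _ _ M _ => h u q hu hA M⟩
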